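/- Let $T$ be a theory in (many-sorted) continuous first-order logic for metric structures and let $\mathcal H$ be a piecewise interpretable real Hilbert space in $T$: a family $(S_i)_{i\in I}$ of imaginary sorts of $T$ (countable products of sorts with a $T$-definable pseudometric, interpreted in a model $M$ by the Hausdorff completion $S_i(M)$) together with $T$-definable maps $f_{ij}:S_i\times S_j\to\mathbb R$ which in every model $M$ form a symmetric positive semidefinite kernel on $\bigsqcup_i S_i(M)$. Let $H(M)$ be the real Hilbert space generated by this kernel, with canonical maps $h:S_i(M)\to H(M)$, so that $\langle h x,h y\rangle=f_{ij}(x,y)$ and the vectors $hx$ have dense span; $\mathrm{Aut}(M)$, with the topology of pointwise convergence, acts on $H(M)$ by the canonical unitary representation $\pi(g)hx=h(gx)$. Let $p$ be a complete type of $T$ (over $\emptyset$) in a piece $S_i$ on which $h$ is isometric in every model of $T$. Suppose that $p$ is asymptotically free: for every $M\models T$, every realisation $x$ of $p$ in $M$ and every $\varepsilon>0$, the set of realisations $y$ of $p$ in $M$ with $|\langle hx,hy\rangle|\ge\varepsilon$ is compact. For $M\models T$ let $p(M)$ be the set of realisations of $p$ in $M$, and let $H_p(M)$ be the closed linear span of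 $h(p(M))$. For an element $x$ of $M$ let $\mathrm{bdd}(x)$ be the bounded closure of $x$, that is, the set of all elements $b$ of $M$ (in real or imaginary sorts) such that the set of realisations of $\mathrm{tp}(b/x)$ is compact in every elementary extension of $M$. For $x\in p(M)$ put $[x]=\{y\in p(M):\mathrm{bdd}(y)=\mathrm{bdd}(x)\}$. Let $M\models T$, let $G=\mathrm{Aut}(M)$, and suppose that the orbit under $G$ of some $a_0\in p(M)$ is metrically dense in $p(M)$. Let $a\in p(M)$, let $K=\{g\in G: g[a]=[a]\}$, let $V$ be the closed linear span of $h([a])$ in $H(M)$, and let $\sigma$ be the representation of $K$ on $V$ obtained by restricting $\pi$. Then $K$ is an open subgroup of $G$, the canonical representation $\pi$ of $G$ on $H_p(M)$ is continuous, and it is unitarily equivalent to the induced representation $\mathrm{Ind}_K^G(\sigma)$. Here $\mathrm{Ind}_K^G(\sigma)$ is the unitary representation $g\cdot(g'\otimes v)=gg'\otimes v$ on the Hilbert space completion $G\otimes_\sigma V$ of the space of formal sums of the $g\otimes v$ ($g\in G$, $v\in V$) with respect to the form $\langle g\otimes v,g'\otimes v'\rangle=\langle v,\sigma(g^{-1}g')v'\rangle$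 if $g^{-1}g'\in K$ and $0$ otherwise (so that $gk\otimes v=g\otimes\sigma(k)v$ for $k\in K$). -/

import Mathlib

universe u v w

noncomputable section

namespace CL

/-! ## Metric structures and continuous first-order logic (many-sorted) -/

/-- A many-sorted signature for metric structures.  Every sort carries a bound for its diameter,
every function symbol a modulus of uniform continuity, every predicate symbol a bound and a modulus
of uniform continuity. -/
structure Lang where
  Srt : Type u
  diam : Srt → ℝ
  Fn : Type u
  fnArity : Fn → ℕ
  fnDom : (f : Fn) → Fin (fnArity f) → Srt
  fnCod : Fn → Srt
  fnMod : Fn → ℝ → ℝ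
  fnMod_pos : ∀ f ε, 0 < ε → 0 < fnMod f ε
  Rel : Type u
  relArity : Rel → ℕ
  relDom : (R : Rel) → Fin (relArity R) → Srt
  relBound : Rel → ℝ
  relMod : Rel → ℝ → ℝ
  relMod_pos : ∀ R ε, 0 < ε → 0 < relMod R ε

/-- A metric structure: every sort is a nonempty complete bounded metric space, and the symbols are
interpreted by functions that respect the bounds and the moduli of the signature. -/
structure Structure (L : Lang.{u}) where
  carrier : L.Srt → Type u
  [metric : ∀ s, MetricSpace (carrier s)]
  [complete : ∀ s, CompleteSpace (carrier s)]
  [nonempty : ∀ s, Nonempty (carrier s)]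
  dist_le : ∀ s (x y : carrier s), dist x y ≤ L.diam s
  fn : ∀ f : L.Fn, (∀ k, carrier (L.fnDom f k)) → carrier (L.fnCod f)
  fn_uc : ∀ (f : L.Fn) (ε : ℝ), 0 < ε → ∀ x y : (∀ k, carrier (L.fnDom f k)),
    (∀ k, dist (x k) (y k) < L.fnMod f ε) → dist (fn f x) (fn f y) ≤ ε
  rel : ∀ R : L.Rel, (∀ k, carrier (L.relDom R k)) → ℝ
  rel_le : ∀ R x, |rel R x| ≤ L.relBound R
  rel_uc : ∀ (R : L.Rel) (ε : ℝ), 0 < ε → ∀ x y : (∀ k, carrier (L.relDom R k)),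
    (∀ k, dist (x k) (y k) < L.relMod R ε) → |rel R x - rel R y| ≤ ε

attribute [instance] Structure.metric Structure.complete Structure.nonempty

/-- Terms in the free variables `0, …, n - 1`, where variable `k` has sort `σ k`. -/
inductive Term (L : Lang.{u}) {n : ℕ} (σ : Fin n → L.Srt) : L.Srt → Type u
  | var (k : Fin n) : Term L σ (σ k)
  | app (f : L.Fn) (ts : ∀ k, Term L σ (L.fnDom f k)) : Term L σ (L.fnCod f)

/-- Formulas of continuous logic with free variables `0, …, n - 1`, variable `k` of sort `σ k`:
atomic formulas are distances and predicates, connectives are continuous functions, quantifiers are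
`sup` and `inf` (which bind the variable `0`). -/
inductive Formula (L : Lang.{u}) : (n : ℕ) → (Fin n → L.Srt) → Type u
  | dist {n : ℕ} {σ : Fin n → L.Srt} {s : L.Srt} (t t' : Term L σ s) : Formula L n σ
  | rel {n : ℕ} {σ : Fin n → L.Srt} (R : L.Rel) (ts : ∀ k, Term L σ (L.relDom R k)) :
      Formula L n σ
  | conn {n : ℕ} {σ : Fin n → L.Srt} (m : ℕ) (c : C(Fin m → ℝ, ℝ))
      (φ : Fin m → Formula L n σ) : Formula L n σ
  | sup {n : ℕ} {σ : Fin n → L.Srt} (s : L.Srt)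
      (φ : Formula L (n + 1) (Fin.cons (α := fun _ => L.Srt) s σ)) : Formula L n σ
  | inf {n : ℕ} {σ : Fin n → L.Srt} (s : L.Srt)
      (φ : Formula L (n + 1) (Fin.cons (α := fun _ => L.Srt) s σ)) : Formula L n σ

variable {L : Lang.{u}}

/-- The value of a term at a valuation of its variables. -/
def Term.eval (M : Structure L) {n : ℕ} {σ : Fin n → L.Srt} (v : ∀ k, M.carrier (σ k)) :
    ∀ {s : L.Srt}, Term L σ s → M.carrier s
  | _, .var k => v k
  | _, .app f ts => M.fn f fun k => (ts k).eval M v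

/-- Extend a valuation by a value for the new variable `0`. -/
def extend (M : Structure L) {n : ℕ} {σ : Fin n → L.Srt} {s : L.Srt} (a : M.carrier s)
    (v : ∀ k, M.carrier (σ k)) :
    ∀ k : Fin (n + 1), M.carrier (Fin.cons (α := fun _ => L.Srt) s σ k) :=
  Fin.cases a v

/-- The (real) value of a formula at a valuation of its free variables. -/
def Formula.eval (M : Structure L) : ∀ {n : ℕ} {σ : Fin n → L.Srt}, Formula L n σ →
    (∀ k, M.carrier (σ k)) → ℝ
  | _, _, .dist t t', v => Dist.dist (t.eval M v) (t'.eval M v)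
  | _, _, .rel R ts, v => M.rel R fun k => (ts k).eval M v
  | _, _, .conn _ c φ, v => c fun i => (φ i).eval M v
  | _, _, .sup _ φ, v => ⨆ a, φ.eval M (extend M a v)
  | _, _, .inf _ φ, v => ⨅ a, φ.eval M (extend M a v)

/-- A theory is a set of sentences `φ`, each understood as the closed condition `φ = 0`. -/
abbrev Theory (L : Lang.{u}) := Set (Formula L 0 Fin.elim0)

/-- Models of a theory. -/
structure Model (T : Theory L) where
  str : Structure L
  sat : ∀ φ ∈ T, φ.eval str (fun k => k.elim0) = 0

/-- Elementary embeddings: maps that preserve the values of all formulas. -/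
structure ElemEmb (M N : Structure L) where
  toFun : ∀ s, M.carrier s → N.carrier s
  map_formula : ∀ {n : ℕ} {σ : Fin n → L.Srt} (φ : Formula L n σ) (v : ∀ k, M.carrier (σ k)),
    φ.eval N (fun k => toFun (σ k) (v k)) = φ.eval M v

/-- Automorphisms of a metric structure. -/
@[ext] structure Aut (M : Structure L) where
  toEquiv : ∀ s, M.carrier s ≃ M.carrier s
  isometry : ∀ s (x y : M.carrier s), dist (toEquiv s x) (toEquiv s y) = dist x y
  map_fn : ∀ (f : L.Fn) x, toEquiv _ (M.fn f x) = M.fn f fun k => toEquiv _ (x k)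
  map_rel : ∀ (R : L.Rel) x, M.rel R (fun k => toEquiv _ (x k)) = M.rel R x

namespace Aut

variable {M : Structure L}

instance : One (Aut M) := ⟨⟨fun _ => 1, fun _ _ _ => rfl, fun _ _ => rfl, fun _ _ => rfl⟩⟩

instance : Mul (Aut M) :=
  ⟨fun g h => ⟨fun s => g.toEquiv s * h.toEquiv s,
    fun s x y => by simp [g.isometry, h.isometry],
    fun f x => by simp [g.map_fn, h.map_fn],
    fun R x => by
      have := g.map_rel R fun k => h.toEquiv _ (x k)
      simpa [h.map_rel] using this⟩⟩

instance : Inv (Aut M) :=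
  ⟨fun g => ⟨fun s => (g.toEquiv s)⁻¹,
    fun s x y => by
      have := g.isometry s ((g.toEquiv s)⁻¹ x) ((g.toEquiv s)⁻¹ y)
      simpa using this.symm,
    fun f x => by
      apply (g.toEquiv _).injective
      simp [g.map_fn],
    fun R x => by
      have := g.map_rel R fun k => (g.toEquiv _)⁻¹ (x k)
      simpa using this.symm⟩⟩

instance : Group (Aut M) :=
  Group.ofLeftAxioms (fun _ _ _ => rfl) (fun _ => rfl) fun g => by
    apply Aut.ext
    funext s
    exact inv_mul_cancel (g.toEquiv s)

/-- The topology of pointwise convergence. -/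
instance : TopologicalSpace (Aut M) :=
  TopologicalSpace.induced
    (fun (g : Aut M) (x : Σ s, M.carrier s) => g.toEquiv x.1 x.2) Pi.topologicalSpace

theorem term_eval (g : Aut M) {n : ℕ} {σ : Fin n → L.Srt} (v : ∀ k, M.carrier (σ k))
    {s : L.Srt} (t : Term L σ s) :
    t.eval M (fun k => g.toEquiv _ (v k)) = g.toEquiv s (t.eval M v) := by
  induction t with
  | var k => rfl
  | app f ts ih => simp only [Term.eval, ih, g.map_fn]

theorem formula_eval (g : Aut M) {n : ℕ} {σ : Fin n → L.Srt} (φ : Formula L n σ) :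
    ∀ v : (∀ k, M.carrier (σ k)), φ.eval M (fun k => g.toEquiv _ (v k)) = φ.eval M v := by
  have key : ∀ {n : ℕ} {σ : Fin n → L.Srt} {s : L.Srt} (a : M.carrier s)
      (v : ∀ k, M.carrier (σ k)),
      extend M (g.toEquiv s a) (fun k => g.toEquiv _ (v k)) =
        fun k => g.toEquiv _ (extend M a v k) := by
    intro n σ s a v
    funext k
    refine Fin.cases ?_ (fun i => ?_) k <;> rfl
  induction φ with
  | dist t t' => intro v; simp only [Formula.eval, term_eval, g.isometry]
  | rel R ts => intro v; simp only [Formula.eval, term_eval, g.map_rel]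
  | conn m c φ ih => intro v; simp only [Formula.eval, ih]
  | sup s φ ih =>
    intro v
    simp only [Formula.eval]
    rw [← (g.toEquiv s).iSup_comp]
    exact iSup_congr fun a => by rw [key, ih]
  | inf s φ ih =>
    intro v
    simp only [Formula.eval]
    rw [← (g.toEquiv s).iInf_comp]
    exact iInf_congr fun a => by rw [key, ih]

/-- An automorphism is an elementary embedding. -/
def toElemEmb (g : Aut M) : ElemEmb M M where
  toFun s := g.toEquiv s
  map_formula φ v := g.formula_eval φ v

end Aut

/-! ## Definable predicates, imaginary sorts, types, bounded closure -/

variable {T : Theory L}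

/-- A family of functions `F M : ∏ a, M (σ a) → ℝ`, one for each model `M` of `T`, in a possibly
infinite tuple of variables, is (`∅`-)definable in `T` if it is a uniform limit, uniformly in all
models, of formulas (each of which involves only finitely many of the variables). -/
def IsDefinable (T : Theory L) {α : Type} (σ : α → L.Srt)
    (F : ∀ M : Model T, (∀ a, M.str.carrier (σ a)) → ℝ) : Prop :=
  ∀ ε : ℝ, 0 < ε → ∃ (n : ℕ) (ρ : Fin n → α) (φ : Formula L n fun k => σ (ρ k)),
    ∀ (M : Model T) (x : ∀ a, M.str.carrier (σ a)),
      |F M x - φ.eval M.str (fun k => x (ρ k))| ≤ ε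

theorem IsDefinable.map {α : Type} {σ : α → L.Srt}
    {F : ∀ M : Model T, (∀ a, M.str.carrier (σ a)) → ℝ} (hF : IsDefinable T σ F)
    {M N : Model T} (j : ElemEmb M.str N.str) (x : ∀ a, M.str.carrier (σ a)) :
    F N (fun a => j.toFun _ (x a)) = F M x := by
  refine eq_of_forall_dist_le fun ε hε => ?_
  obtain ⟨n, ρ, φ, h⟩ := hF (ε / 2) (by positivity)
  have h1 := h M x
  have h2 := h N fun a => j.toFun _ (x a)
  rw [j.map_formula φ fun k => x (ρ k)] at h2
  rw [Real.dist_eq]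
  rw [abs_le] at *
  constructor <;> linarith [h1.1, h1.2, h2.1, h2.2]

/-- An imaginary sort of `T`: a product of at most countably many sorts with a pseudometric that is
definable in `T`. -/
structure ImagSort (T : Theory L) where
  ι : Type
  countable : Countable ι
  srt : ι → L.Srt
  d : ∀ M : Model T, (∀ i, M.str.carrier (srt i)) → (∀ i, M.str.carrier (srt i)) → ℝ
  definable : IsDefinable T (Sum.elim srt srt) fun M x =>
    d M (fun i => x (Sum.inl i)) (fun i => x (Sum.inr i))
  d_self : ∀ M x, d M x x = 0
  d_comm : ∀ M x y, d M x y = d M y x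
  d_triangle : ∀ M x y z, d M x z ≤ d M x y + d M y z

namespace ImagSort

/-- The product of sorts underlying an imaginary sort, with the pseudometric `d`. -/
structure Pre (E : ImagSort T) (M : Model T) where
  val : ∀ i, M.str.carrier (E.srt i)

instance (E : ImagSort T) (M : Model T) : PseudoMetricSpace (E.Pre M) where
  dist x y := E.d M x.val y.val
  dist_self x := E.d_self M x.val
  dist_comm x y := E.d_comm M x.val y.val
  dist_triangle x y z := E.d_triangle M x.val y.val z.val

/-- The interpretation of an imaginary sort in a model: the Hausdorff completion of the product of
sorts for the pseudometric `d`. -/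
abbrev Elt (E : ImagSort T) (M : Model T) : Type u := UniformSpace.Completion (E.Pre M)

/-- The element of the imaginary sort that is represented by a tuple. -/
def rep (E : ImagSort T) {M : Model T} (x : ∀ i, M.str.carrier (E.srt i)) : E.Elt M :=
  ((⟨x⟩ : E.Pre M) : UniformSpace.Completion (E.Pre M))

/-- The action of an elementary embedding on representatives. -/
def preMap (E : ImagSort T) {M N : Model T} (j : ElemEmb M.str N.str) (x : E.Pre M) : E.Pre N :=
  ⟨fun i => j.toFun _ (x.val i)⟩

theorem isometry_preMap (E : ImagSort T) {M N : Model T} (j : ElemEmb M.str N.str) :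
    Isometry (E.preMap j) := by
  refine Isometry.of_dist_eq fun x y => ?_
  have h := E.definable.map j
    (fun a => Sum.rec (motive := fun a => M.str.carrier (Sum.elim E.srt E.srt a)) x.val y.val a)
  exact h

/-- The action of an elementary embedding on an imaginary sort. -/
def map (E : ImagSort T) {M N : Model T} (j : ElemEmb M.str N.str) : E.Elt M → E.Elt N :=
  UniformSpace.Completion.map (E.preMap j)

theorem map_rep (E : ImagSort T) {M N : Model T} (j : ElemEmb M.str N.str)
    (x : ∀ i, M.str.carrier (E.srt i)) :
    E.map j (E.rep x) = E.rep fun i => j.toFun _ (x i) :=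
  UniformSpace.Completion.map_coe (E.isometry_preMap j).uniformContinuous _

theorem isometry_map (E : ImagSort T) {M N : Model T} (j : ElemEmb M.str N.str) :
    Isometry (E.map j) :=
  (E.isometry_preMap j).completion_map

/-- Automorphisms act on every imaginary sort. -/
instance (E : ImagSort T) (M : Model T) : MulAction (Aut M.str) (E.Elt M) where
  smul g x := E.map g.toElemEmb x
  one_smul x := by
    change UniformSpace.Completion.map (E.preMap (Aut.toElemEmb 1)) x = x
    have : E.preMap (M := M) (Aut.toElemEmb 1) = id := rfl
    rw [this, UniformSpace.Completion.map_id, id]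
  mul_smul g h x := by
    change UniformSpace.Completion.map (E.preMap (Aut.toElemEmb (g * h))) x =
      UniformSpace.Completion.map (E.preMap (Aut.toElemEmb g))
        (UniformSpace.Completion.map (E.preMap (Aut.toElemEmb h)) x)
    have : E.preMap (M := M) (Aut.toElemEmb (g * h)) =
      E.preMap (Aut.toElemEmb g) ∘ E.preMap (Aut.toElemEmb h) := rfl
    rw [this, ← UniformSpace.Completion.map_comp
      (E.isometry_preMap _).uniformContinuous (E.isometry_preMap _).uniformContinuous]
    rfl

theorem smul_def (E : ImagSort T) {M : Model T} (g : Aut M.str) (x : E.Elt M) :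
    g • x = E.map g.toElemEmb x := rfl

end ImagSort

/-- A definable predicate `E → ℝ` on an imaginary sort: a uniformly continuous function on (the
completion) `E M`, uniformly in all models `M`, which is definable on representatives. -/
structure ImagPred (E : ImagSort T) where
  val : ∀ M : Model T, E.Elt M → ℝ
  definable : IsDefinable T E.srt fun M x => val M (E.rep x)
  uc : ∀ ε : ℝ, 0 < ε → ∃ δ : ℝ, 0 < δ ∧ ∀ (M : Model T) (x y : E.Elt M),
    dist x y < δ → |val M x - val M y| ≤ ε

/-- A definable predicate `E × E' → ℝ` on a product of two imaginary sorts. -/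
structure ImagPred₂ (E E' : ImagSort T) where
  val : ∀ M : Model T, E.Elt M → E'.Elt M → ℝ
  definable : IsDefinable T (Sum.elim E.srt E'.srt) fun M x =>
    val M (E.rep fun i => x (Sum.inl i)) (E'.rep fun i => x (Sum.inr i))
  uc : ∀ ε : ℝ, 0 < ε → ∃ δ : ℝ, 0 < δ ∧ ∀ (M : Model T) (x y : E.Elt M) (x' y' : E'.Elt M),
    dist x y < δ → dist x' y' < δ → |val M x x' - val M y y'| ≤ ε

theorem ImagPred.continuous {E : ImagSort T} (f : ImagPred E) (M : Model T) :
    Continuous (f.val M) := by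
  refine Metric.continuous_iff.2 fun x ε hε => ?_
  obtain ⟨δ, hδ, h⟩ := f.uc (ε / 2) (by positivity)
  refine ⟨δ, hδ, fun y hy => ?_⟩
  rw [Real.dist_eq]
  linarith [h M y x hy]

theorem ImagPred₂.continuous {E E' : ImagSort T} (f : ImagPred₂ E E') (M : Model T) :
    Continuous fun x : E.Elt M × E'.Elt M => f.val M x.1 x.2 := by
  refine Metric.continuous_iff.2 fun x ε hε => ?_
  obtain ⟨δ, hδ, h⟩ := f.uc (ε / 2) (by positivity)
  refine ⟨δ, hδ, fun y hy => ?_⟩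
  rw [Prod.dist_eq, max_lt_iff] at hy
  rw [Real.dist_eq]
  linarith [h M _ _ _ _ hy.1 hy.2]

theorem ImagPred.map {E : ImagSort T} (f : ImagPred E) {M N : Model T}
    (j : ElemEmb M.str N.str) (x : E.Elt M) : f.val N (E.map j x) = f.val M x := by
  induction x using UniformSpace.Completion.induction_on with
  | hp => exact isClosed_eq ((f.continuous N).comp (E.isometry_map j).continuous) (f.continuous M)
  | ih a =>
    have h := f.definable.map j a.val
    simp only [← E.map_rep] at h
    exact h

theorem ImagPred₂.map {E E' : ImagSort T} (f : ImagPred₂ E E') {M N : Model T}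
    (j : ElemEmb M.str N.str) (x : E.Elt M) (y : E'.Elt M) :
    f.val N (E.map j x) (E'.map j y) = f.val M x y := by
  induction x, y using UniformSpace.Completion.induction_on₂ with
  | hp =>
    exact isClosed_eq ((f.continuous N).comp
      (((E.isometry_map j).continuous.comp continuous_fst).prodMk
        ((E'.isometry_map j).continuous.comp continuous_snd))) (f.continuous M)
  | ih a b =>
    have h := f.definable.map j (fun c =>
      Sum.rec (motive := fun c => M.str.carrier (Sum.elim E.srt E'.srt c)) a.val b.val c)
    have h1 : E.map j a = E.rep fun i => j.toFun _ (a.val i) := E.map_rep j a.val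
    have h2 : E'.map j b = E'.rep fun i => j.toFun _ (b.val i) := E'.map_rep j b.val
    rw [h1, h2]
    exact h

/-- A complete type of `T` in an imaginary sort: an assignment of a value to every definable
predicate which is realised in some model of `T`. -/
structure CompleteType (E : ImagSort T) where
  val : ImagPred E → ℝ
  consistent : ∃ (M : Model T) (x : E.Elt M), ∀ f : ImagPred E, f.val M x = val f

/-- The set of realisations of a complete type in a model. -/
def CompleteType.realisations {E : ImagSort T} (p : CompleteType E) (M : Model T) :
    Set (E.Elt M) :=
  {x | ∀ f : ImagPred E, f.val M x = p.val f}

theorem CompleteType.smul_mem {E : ImagSort T} (p : CompleteType E) {M : Model T}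
    (g : Aut M.str) {x : E.Elt M} (hx : x ∈ p.realisations M) : g • x ∈ p.realisations M :=
  fun f => by rw [ImagSort.smul_def, f.map, hx f]

/-- The realisations in an elementary extension `j : M → N` of the type of `b` over `x`. -/
def conjugates {E S : ImagSort T} {M N : Model T} (j : ElemEmb M.str N.str) (b : E.Elt M)
    (x : S.Elt M) : Set (E.Elt N) :=
  {b' | ∀ f : ImagPred₂ E S, f.val N b' (S.map j x) = f.val M b x}

/-- The bounded closure of `x` in `M`: all elements `b` (of all sorts, including the imaginary
ones) such that the type of `b` over `x` has a compact set of realisations in every elementary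
extension of `M`. -/
def bdd {S : ImagSort T} {M : Model T} (x : S.Elt M) : Set (Σ E : ImagSort T, E.Elt M) :=
  {b | ∀ (N : Model T) (j : ElemEmb M.str N.str), IsCompact (conjugates j b.2 x)}

/-! ## Hilbert spaces generated by positive semidefinite kernels, and unitary representations -/

/-- A positive semidefinite kernel on a set `X` whose values are bilinear forms on a real vector
space `V`. -/
structure PSDKernel (X : Type v) (V : Type w) [AddCommGroup V] [Module ℝ V] where
  form : X → X → V →ₗ[ℝ] V →ₗ[ℝ] ℝ
  symm : ∀ x y a b, form x y a b = form y x b a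
  nonneg : ∀ f : X →₀ V, 0 ≤ f.sum fun x a => f.sum fun y b => form x y a b

namespace PSDKernel

variable {X : Type v} {V : Type w} [AddCommGroup V] [Module ℝ V]

/-- The semi-inner product on formal finite sums of the `x ⊗ a` (with `x : X` and `a : V`) that is
given by `⟨x ⊗ a, y ⊗ b⟩ = form x y a b`. -/
@[reducible] def core (k : PSDKernel X V) : PreInnerProductSpace.Core ℝ (X →₀ V) where
  inner f f' := f.sum fun x a => f'.sum fun y b => k.form x y a b
  conj_inner_symm f f' := by
    simp only [conj_trivial]
    rw [Finsupp.sum_comm]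
    simp only [k.symm]
  re_inner_nonneg f := k.nonneg f
  add_left f f' f'' := by
    refine Finsupp.sum_add_index' (fun x => by simp) fun x a b => ?_
    simp [Finsupp.sum, Finset.sum_add_distrib]
  smul_left f f' r := by
    refine (Finsupp.sum_smul_index' (fun x => by simp)).trans ?_
    simp [Finsupp.sum, Finset.mul_sum]

/-- The space of formal finite sums of the `x ⊗ a`, with this semi-inner product. -/
def Pre (_k : PSDKernel X V) : Type (max v w) := X →₀ V

instance (k : PSDKernel X V) : SeminormedAddCommGroup k.Pre :=
  @InnerProductSpace.Core.toSeminormedAddCommGroup ℝ (X →₀ V) _ _ _ k.core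

instance (k : PSDKernel X V) : InnerProductSpace ℝ k.Pre :=
  @InnerProductSpace.ofCore ℝ (X →₀ V) _ _ _ k.core

/-- A formal sum as an element of `k.Pre`. -/
def toPre (k : PSDKernel X V) : (X →₀ V) ≃ₗ[ℝ] k.Pre := LinearEquiv.refl ℝ (X →₀ V)

theorem inner_toPre (k : PSDKernel X V) (f f' : X →₀ V) :
    inner ℝ (k.toPre f) (k.toPre f') = f.sum fun x a => f'.sum fun y b => k.form x y a b := rfl

/-- The Hilbert space generated by a positive semidefinite kernel: the Hausdorff completion of the
space of formal sums. -/
abbrev Hilbert (k : PSDKernel X V) : Type (max v w) := UniformSpace.Completion k.Pre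

/-- The vector `x ⊗ a`. -/
def vec (k : PSDKernel X V) (x : X) (a : V) : k.Hilbert :=
  ((k.toPre (Finsupp.single x a) : k.Pre) : UniformSpace.Completion k.Pre)

theorem inner_vec (k : PSDKernel X V) (x y : X) (a b : V) :
    inner ℝ (k.vec x a) (k.vec y b) = k.form x y a b := by
  refine (UniformSpace.Completion.inner_coe _ _).trans ?_
  rw [inner_toPre]
  simp

/-- The linear isometry of the space of formal sums that is induced by a permutation of `X` which
preserves the kernel. -/
def preIsometry (k : PSDKernel X V) (e : Equiv.Perm X)
    (he : ∀ x y, k.form (e x) (e y) = k.form x y) : k.Pre ≃ₗᵢ[ℝ] k.Pre :=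
  LinearEquiv.isometryOfInner
    (k.toPre.symm.trans ((Finsupp.domLCongr e).trans k.toPre)) fun f f' => by
      obtain ⟨f, rfl⟩ := k.toPre.surjective f
      obtain ⟨f', rfl⟩ := k.toPre.surjective f'
      simp only [LinearEquiv.trans_apply, LinearEquiv.symm_apply_apply, inner_toPre,
        Finsupp.domLCongr_apply, Finsupp.domCongr_apply, Finsupp.equivMapDomain_eq_mapDomain]
      rw [Finsupp.sum_mapDomain_index_inj e.injective]
      refine Finsupp.sum_congr fun x _ => ?_
      rw [Finsupp.sum_mapDomain_index_inj e.injective]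
      simp only [he]

theorem preIsometry_toPre_single (k : PSDKernel X V) (e : Equiv.Perm X)
    (he : ∀ x y, k.form (e x) (e y) = k.form x y) (x : X) (a : V) :
    k.preIsometry e he (k.toPre (Finsupp.single x a)) = k.toPre (Finsupp.single (e x) a) := by
  change k.toPre (Finsupp.domLCongr e (Finsupp.single x a)) = _
  simp

/-- The extension to the Hilbert space of such a linear isometry: `x ⊗ a ↦ e x ⊗ a`. -/
def isometry (k : PSDKernel X V) (e : Equiv.Perm X)
    (he : ∀ x y, k.form (e x) (e y) = k.form x y) : k.Hilbert →ₗᵢ[ℝ] k.Hilbert where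
  toLinearMap :=
    ((k.preIsometry e he).toContinuousLinearEquiv : k.Pre →L[ℝ] k.Pre).completion.toLinearMap
  norm_map' x := by
    have h : Isometry (UniformSpace.Completion.map (k.preIsometry e he)) :=
      (k.preIsometry e he).isometry.completion_map
    have h0 : UniformSpace.Completion.map (k.preIsometry e he) 0 = 0 := by
      rw [← UniformSpace.Completion.coe_zero, UniformSpace.Completion.map_coe
        (k.preIsometry e he).isometry.uniformContinuous, map_zero]
    have := h.dist_eq x 0
    rw [h0, dist_zero_right, dist_zero_right] at this
    exact this

theorem isometry_vec (k : PSDKernel X V) (e : Equiv.Perm X)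
    (he : ∀ x y, k.form (e x) (e y) = k.form x y) (x : X) (a : V) :
    k.isometry e he (k.vec x a) = k.vec (e x) a := by
  refine (ContinuousLinearMap.completion_apply_coe _ _).trans ?_
  exact congrArg _ (k.preIsometry_toPre_single e he x a)

/-- Bounded linear maps that agree on all vectors `x ⊗ a` are equal. -/
theorem hom_ext (k : PSDKernel X V) {F : Type*} [NormedAddCommGroup F] [NormedSpace ℝ F]
    {A B : k.Hilbert →L[ℝ] F} (h : ∀ x a, A (k.vec x a) = B (k.vec x a)) : A = B := by
  ext z
  induction z using UniformSpace.Completion.induction_on with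
  | hp => exact isClosed_eq A.continuous B.continuous
  | ih f =>
    obtain ⟨f, rfl⟩ := k.toPre.surjective f
    induction f using Finsupp.induction_linear with
    | zero => rw [map_zero, UniformSpace.Completion.coe_zero, map_zero, map_zero]
    | add f f' hf hf' => rw [map_add, UniformSpace.Completion.coe_add, map_add, map_add, hf, hf']
    | single x a => exact h x a

section Representation

variable {G : Type*} [Group G] [MulAction G X]

/-- The isometry `x ⊗ a ↦ (g x) ⊗ a`. -/
def actIsometry (k : PSDKernel X V)
    (hk : ∀ (g : G) (x y : X), k.form (g • x) (g • y) = k.form x y) (g : G) :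
    k.Hilbert →ₗᵢ[ℝ] k.Hilbert :=
  k.isometry (MulAction.toPerm g) fun x y => by simpa using hk g x y

theorem actIsometry_vec (k : PSDKernel X V)
    (hk : ∀ (g : G) (x y : X), k.form (g • x) (g • y) = k.form x y) (g : G) (x : X) (a : V) :
    k.actIsometry hk g (k.vec x a) = k.vec (g • x) a :=
  k.isometry_vec _ _ x a

theorem actIsometry_mul (k : PSDKernel X V)
    (hk : ∀ (g : G) (x y : X), k.form (g • x) (g • y) = k.form x y) (g h l : G) (hl : g * h = l)
    (z : k.Hilbert) :
    k.actIsometry hk g (k.actIsometry hk h z) = k.actIsometry hk l z := by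
  have := k.hom_ext
    (A := ((k.actIsometry hk g).comp (k.actIsometry hk h)).toContinuousLinearMap)
    (B := (k.actIsometry hk l).toContinuousLinearMap) fun x a => by
      change k.actIsometry hk g (k.actIsometry hk h (k.vec x a)) =
        k.actIsometry hk l (k.vec x a)
      rw [actIsometry_vec, actIsometry_vec, actIsometry_vec, ← hl, mul_smul]
  exact DFunLike.congr_fun this z

theorem actIsometry_one (k : PSDKernel X V)
    (hk : ∀ (g : G) (x y : X), k.form (g • x) (g • y) = k.form x y) (z : k.Hilbert) :
    k.actIsometry hk 1 z = z := by
  have := k.hom_ext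
    (A := (k.actIsometry hk 1).toContinuousLinearMap)
    (B := ContinuousLinearMap.id ℝ _) fun x a => by
      change k.actIsometry hk 1 (k.vec x a) = k.vec x a
      rw [actIsometry_vec, one_smul]
  exact DFunLike.congr_fun this z

/-- The unitary representation `g (x ⊗ a) = (g x) ⊗ a` on the Hilbert space of a kernel that is
invariant under an action of the group `G` on `X`. -/
def rep (k : PSDKernel X V)
    (hk : ∀ (g : G) (x y : X), k.form (g • x) (g • y) = k.form x y) :
    G →* (k.Hilbert ≃ₗᵢ[ℝ] k.Hilbert) where
  toFun g :=
    { toLinearEquiv := LinearEquiv.ofLinearMap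
        (k.actIsometry hk g).toLinearMap (k.actIsometry hk g⁻¹).toLinearMap
        (LinearMap.ext fun z => (k.actIsometry_mul hk g g⁻¹ 1 (mul_inv_cancel g) z).trans
          (k.actIsometry_one hk z))
        (LinearMap.ext fun z => (k.actIsometry_mul hk g⁻¹ g 1 (inv_mul_cancel g) z).trans
          (k.actIsometry_one hk z))
      norm_map' := (k.actIsometry hk g).norm_map }
  map_one' := LinearIsometryEquiv.ext fun z => k.actIsometry_one hk z
  map_mul' g h := LinearIsometryEquiv.ext fun z => (k.actIsometry_mul hk g h (g * h) rfl z).symm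

theorem rep_vec (k : PSDKernel X V)
    (hk : ∀ (g : G) (x y : X), k.form (g • x) (g • y) = k.form x y) (g : G) (x : X) (a : V) :
    k.rep hk g (k.vec x a) = k.vec (g • x) a :=
  k.actIsometry_vec hk g x a

end Representation

end PSDKernel

section Induced

variable {G : Type v} [Group G] {V : Type w} [NormedAddCommGroup V] [InnerProductSpace ℝ V]
  (K : Subgroup G) (σ : K →* (V ≃ₗᵢ[ℝ] V))

open Classical in
/-- The bilinear forms `(a, b) ↦ ⟨g ⊗ a, g' ⊗ b⟩` on `V`: this is `⟨a, σ(k) b⟩` if `g' = g k` with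
`k ∈ K`, and `0` if `g` and `g'` are in different left cosets of `K`. -/
def inducedForm (g g' : G) : V →ₗ[ℝ] V →ₗ[ℝ] ℝ :=
  if h : g⁻¹ * g' ∈ K then
    (innerₗ V).compl₂ (σ ⟨g⁻¹ * g', h⟩).toLinearEquiv.toLinearMap
  else 0

/-- Transport of `a` at `g` to the chosen representative of the coset `g K`. -/
def cosetMap (g : G) : V →ₗ[ℝ] V :=
  (σ ⟨(QuotientGroup.mk g : G ⧸ K).out⁻¹ * g,
    QuotientGroup.eq.1 (QuotientGroup.out_eq' _)⟩).toLinearEquiv.toLinearMap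

open Classical in
theorem inducedForm_eq (g g' : G) (a b : V) :
    inducedForm K σ g g' a b =
      if (QuotientGroup.mk g : G ⧸ K) = QuotientGroup.mk g' then
        inner ℝ (cosetMap K σ g a) (cosetMap K σ g' b) else 0 := by
  by_cases h : (QuotientGroup.mk g : G ⧸ K) = QuotientGroup.mk g'
  · have h' : g⁻¹ * g' ∈ K := QuotientGroup.eq.1 h
    have e : (⟨(QuotientGroup.mk g' : G ⧸ K).out⁻¹ * g',
        QuotientGroup.eq.1 (QuotientGroup.out_eq' _)⟩ : K) =
        ⟨(QuotientGroup.mk g : G ⧸ K).out⁻¹ * g,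
          QuotientGroup.eq.1 (QuotientGroup.out_eq' _)⟩ * ⟨g⁻¹ * g', h'⟩ := by
      apply Subtype.ext
      simp [h, mul_assoc]
    rw [if_pos h, inducedForm, dif_pos h', cosetMap, cosetMap, e, map_mul]
    simp
  · have h' : g⁻¹ * g' ∉ K := fun hh => h (QuotientGroup.eq.2 hh)
    rw [if_neg h, inducedForm, dif_neg h']
    rfl

/-- The kernel on `G` whose Hilbert space is the completed `σ`-tensor product `G ⊗_σ V`. -/
def inducedKernel : PSDKernel G V where
  form := inducedForm K σ
  symm g g' a b := by
    rw [inducedForm_eq, inducedForm_eq]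
    by_cases h : (QuotientGroup.mk g : G ⧸ K) = QuotientGroup.mk g'
    · rw [if_pos h, if_pos h.symm, real_inner_comm]
    · rw [if_neg h, if_neg (Ne.symm h)]
  nonneg f := by
    classical
    set q : G → G ⧸ K := QuotientGroup.mk with hq
    have key : (f.sum fun x a => f.sum fun y b => inducedForm K σ x y a b) =
        ∑ c ∈ f.support.image q, inner ℝ
          (∑ x ∈ f.support with q x = c, cosetMap K σ x (f x))
          (∑ x ∈ f.support with q x = c, cosetMap K σ x (f x)) := by
      simp only [Finsupp.sum, inducedForm_eq, sum_inner, inner_sum]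
      rw [← Finset.sum_fiberwise_of_maps_to (g := q)
        (fun x hx => Finset.mem_image_of_mem q hx)]
      refine Finset.sum_congr rfl fun c _ => Finset.sum_congr rfl fun x hx => ?_
      rw [Finset.sum_filter]
      refine Finset.sum_congr rfl fun y _ => ?_
      rw [← (Finset.mem_filter.1 hx).2]
      by_cases h : q x = q y
      · rw [if_pos h.symm, ← real_inner_comm]
        exact if_pos h
      · rw [if_neg (Ne.symm h)]
        exact if_neg h
    rw [key]
    exact Finset.sum_nonneg fun c _ => real_inner_self_nonneg

theorem inducedKernel_invariant (h g g' : G) :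
    (inducedKernel K σ).form (h • g) (h • g') = (inducedKernel K σ).form g g' := by
  have e : (h • g)⁻¹ * (h • g') = g⁻¹ * g' := by simp [mul_assoc]
  ext a b
  by_cases hK : g⁻¹ * g' ∈ K
  · have hK' : (h • g)⁻¹ * (h • g') ∈ K := by rwa [e]
    have e' : (⟨_, hK'⟩ : K) = ⟨_, hK⟩ := Subtype.ext e
    simp only [inducedKernel, inducedForm, dif_pos hK, dif_pos hK', e']
  · have hK' : (h • g)⁻¹ * (h • g') ∉ K := by rwa [e]
    simp only [inducedKernel, inducedForm, dif_neg hK, dif_neg hK']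

/-- The induced representation `Ind_K^G(σ)` on the completed tensor product `G ⊗_σ V`:
`h (g ⊗ a) = (h g) ⊗ a`. -/
def Ind : G →* ((inducedKernel K σ).Hilbert ≃ₗᵢ[ℝ] (inducedKernel K σ).Hilbert) :=
  (inducedKernel K σ).rep (inducedKernel_invariant K σ)

/-- In the tensor product, `g k ⊗ a = g ⊗ σ(k) a` for `k ∈ K`. -/
theorem inducedKernel_vec_mul (g : G) (k : K) (a : V) :
    (inducedKernel K σ).vec (g * k) a = (inducedKernel K σ).vec g (σ k a) := by
  have h1 : ∀ (g₁ g₂ : G) (k₁ : K) (_ : g₁ * k₁ = g₂) (b c : V),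
      inner ℝ ((inducedKernel K σ).vec g₁ b) ((inducedKernel K σ).vec g₂ c) =
        inner ℝ b (σ k₁ c) := by
    rintro g₁ _ k₁ rfl b c
    rw [PSDKernel.inner_vec]
    have h : g₁⁻¹ * (g₁ * (k₁ : G)) ∈ K := by simp
    simp only [inducedKernel, inducedForm, dif_pos h]
    simp
  rw [← sub_eq_zero, ← inner_self_eq_zero (𝕜 := ℝ), inner_sub_left, inner_sub_right,
    inner_sub_right, h1 (g * k) (g * k) 1 (by simp), h1 g (g * k) k rfl, h1 g g 1 (by simp),
    h1 (g * k) g k⁻¹ (by simp)]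
  simp

end Induced

section Restriction

variable {G : Type*} [Group G] {H : Type*} [NormedAddCommGroup H] [InnerProductSpace ℝ H]

/-- The restriction of a unitary representation to an invariant subspace. -/
def restrict (π : G →* (H ≃ₗᵢ[ℝ] H)) (W : Submodule ℝ H) (hW : ∀ g, ∀ x ∈ W, π g x ∈ W) :
    G →* (W ≃ₗᵢ[ℝ] W) where
  toFun g :=
    { toFun := fun x => ⟨π g x, hW g x x.2⟩
      invFun := fun x => ⟨π g⁻¹ x, hW g⁻¹ x x.2⟩
      map_add' := fun x y => Subtype.ext (map_add (π g) (x : H) y)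
      map_smul' := fun r x => Subtype.ext (map_smul (π g) r (x : H))
      left_inv := fun x => Subtype.ext (by simp [map_inv])
      right_inv := fun x => Subtype.ext (by simp [map_inv])
      norm_map' := fun x => (π g).norm_map x }
  map_one' := by ext; simp
  map_mul' g h := by ext; simp

/-- The closed linear span of a set of vectors. -/
def closedSpan (Y : Set H) : Submodule ℝ H := (Submodule.span ℝ Y).topologicalClosure

theorem closedSpan_invariant (e : H ≃ₗᵢ[ℝ] H) {Y : Set H} (hY : ∀ y ∈ Y, e y ∈ Y) :
    ∀ x ∈ closedSpan Y, e x ∈ closedSpan Y := by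
  intro x hx
  refine map_mem_closure e.continuous hx fun y hy => ?_
  have : Submodule.span ℝ Y ≤ (Submodule.span ℝ Y).comap e.toLinearEquiv.toLinearMap :=
    Submodule.span_le.2 fun z hz => Submodule.subset_span (hY z hz)
  exact this hy

end Restriction

/-- Two unitary representations are equivalent if a surjective isometry intertwines them. -/
def UnitarilyEquivalent {G : Type*} [Group G] {H H' : Type*} [NormedAddCommGroup H]
    [InnerProductSpace ℝ H] [NormedAddCommGroup H'] [InnerProductSpace ℝ H']
    (π : G →* (H ≃ₗᵢ[ℝ] H)) (π' : G →* (H' ≃ₗᵢ[ℝ] H')) : Prop :=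
  ∃ U : H ≃ₗᵢ[ℝ] H', ∀ g x, U (π g x) = π' g (U x)

/-! ## Interpretable Hilbert spaces -/

/-- A (piecewise) interpretable real Hilbert space in `T`, given by its pieces, which are imaginary
sorts of `T`, and by definable inner product maps between the pieces that are together positive
semidefinite in every model of `T`. -/
structure InterpretableHilbert (T : Theory L) where
  I : Type u
  piece : I → ImagSort T
  ip : ∀ i j, ImagPred₂ (piece i) (piece j)
  symm : ∀ (M : Model T) (i j : I) (x : (piece i).Elt M) (y : (piece j).Elt M),
    (ip i j).val M x y = (ip j i).val M y x
  nonneg : ∀ (M : Model T) (c : (Σ i, (piece i).Elt M) →₀ ℝ),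
    0 ≤ c.sum fun x r => c.sum fun y s => r * s * (ip x.1 y.1).val M x.2 y.2

namespace InterpretableHilbert

variable (𝓗 : InterpretableHilbert T)

/-- The kernel `(x, y) ↦ ⟨h x, h y⟩` on the disjoint union of the pieces. -/
def kernel (M : Model T) : PSDKernel (Σ i, (𝓗.piece i).Elt M) ℝ where
  form x y := (𝓗.ip x.1 y.1).val M x.2 y.2 • LinearMap.mul ℝ ℝ
  symm x y a b := by simp [𝓗.symm M x.1 y.1, mul_comm a b]
  nonneg c := by
    have h := 𝓗.nonneg M c
    simpa [mul_comm] using h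

/-- The Hilbert space `H(M)`. -/
abbrev space (M : Model T) : Type u := (𝓗.kernel M).Hilbert

/-- The canonical map `h : M_i → H(M)` on a piece. -/
def h {M : Model T} (i : 𝓗.I) (x : (𝓗.piece i).Elt M) : 𝓗.space M :=
  (𝓗.kernel M).vec ⟨i, x⟩ 1

theorem inner_h {M : Model T} (i j : 𝓗.I) (x : (𝓗.piece i).Elt M) (y : (𝓗.piece j).Elt M) :
    inner ℝ (𝓗.h i x) (𝓗.h j y) = (𝓗.ip i j).val M x y := by
  refine (PSDKernel.inner_vec _ _ _ _ _).trans ?_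
  simp [kernel]

theorem kernel_invariant (M : Model T) (g : Aut M.str) (x y : Σ i, (𝓗.piece i).Elt M) :
    (𝓗.kernel M).form (g • x) (g • y) = (𝓗.kernel M).form x y := by
  change (𝓗.ip x.1 y.1).val M ((𝓗.piece x.1).map g.toElemEmb x.2)
    ((𝓗.piece y.1).map g.toElemEmb y.2) • _ = _
  rw [ImagPred₂.map]
  rfl

/-- The canonical unitary representation of `Aut(M)` on `H(M)`. -/
def rep (M : Model T) : Aut M.str →* (𝓗.space M ≃ₗᵢ[ℝ] 𝓗.space M) :=
  (𝓗.kernel M).rep (𝓗.kernel_invariant M)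

theorem rep_h {M : Model T} (g : Aut M.str) (i : 𝓗.I) (x : (𝓗.piece i).Elt M) :
    𝓗.rep M g (𝓗.h i x) = 𝓗.h i (g • x) :=
  PSDKernel.rep_vec _ _ _ _ _

/-- The canonical map on the piece `i` is isometric (in all models of `T`). -/
def IsometricPiece (i : 𝓗.I) : Prop := ∀ M : Model T, Isometry (𝓗.h (M := M) i)

variable {𝓗} {i : 𝓗.I} (p : CompleteType (𝓗.piece i))

/-- A complete type in a piece is asymptotically free if for every model `M`, every realisation `x`
and every `ε > 0`, the set of all realisations `y` with `|⟨x, y⟩| ≥ ε` is compact. -/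
def AsymptoticallyFree : Prop :=
  ∀ (M : Model T), ∀ x ∈ p.realisations M, ∀ ε : ℝ, 0 < ε →
    IsCompact {y ∈ p.realisations M | ε ≤ |inner ℝ (𝓗.h i x) (𝓗.h i y)|}

/-- The closed subspace `H_p(M)` of `H(M)` generated by the realisations of `p`. -/
def subspace (M : Model T) : Submodule ℝ (𝓗.space M) := closedSpan (𝓗.h i '' p.realisations M)

theorem subspace_invariant (M : Model T) (g : Aut M.str) :
    ∀ x ∈ subspace p M, 𝓗.rep M g x ∈ subspace p M :=
  closedSpan_invariant _ <| by
    rintro _ ⟨x, hx, rfl⟩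
    exact ⟨g • x, p.smul_mem g hx, (𝓗.rep_h g i x).symm⟩

/-- The canonical representation of `Aut(M)` on `H_p(M)`. -/
def repOn (M : Model T) : Aut M.str →* (subspace p M ≃ₗᵢ[ℝ] subspace p M) :=
  restrict (𝓗.rep M) (subspace p M) (subspace_invariant p M)

variable {M : Model T}

/-- The class `[a]` of all realisations of `p` in `M` with the same bounded closure as `a`. -/
def bddClass (a : (𝓗.piece i).Elt M) : Set ((𝓗.piece i).Elt M) :=
  {x ∈ p.realisations M | bdd x = bdd a}

section

open scoped Pointwise

/-- The setwise stabiliser in `Aut(M)` of the class `[a]`. -/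
def stab (a : (𝓗.piece i).Elt M) : Subgroup (Aut M.str) :=
  MulAction.stabilizer (Aut M.str) (bddClass p a)

/-- The closed subspace of `H(M)` spanned by `[a]`. -/
def classSpan (a : (𝓗.piece i).Elt M) : Submodule ℝ (𝓗.space M) :=
  closedSpan (𝓗.h i '' bddClass p a)

theorem smul_mem_bddClass {a : (𝓗.piece i).Elt M} {g : Aut M.str} (hg : g ∈ stab p a)
    {x : (𝓗.piece i).Elt M} (hx : x ∈ bddClass p a) : g • x ∈ bddClass p a := by
  have h : g • bddClass p a = bddClass p a := MulAction.mem_stabilizer_iff.1 hg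
  have h' := Set.smul_mem_smul_set (a := g) hx
  rwa [h] at h'

theorem classSpan_invariant (a : (𝓗.piece i).Elt M) (g : stab p a) :
    ∀ x ∈ classSpan p a, 𝓗.rep M g.1 x ∈ classSpan p a :=
  closedSpan_invariant _ <| by
    rintro _ ⟨x, hx, rfl⟩
    exact ⟨g.1 • x, smul_mem_bddClass p g.2 hx, (𝓗.rep_h g.1 i x).symm⟩

end

/-- The representation `σ` of the stabiliser of `[a]` on the Hilbert space spanned by `[a]`. -/
def repClass (a : (𝓗.piece i).Elt M) : stab p a →* (classSpan p a ≃ₗᵢ[ℝ] classSpan p a) :=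
  restrict ((𝓗.rep M).comp (stab p a).subtype) (classSpan p a) (classSpan_invariant p a)

end InterpretableHilbert

end CL
end

/-!
The heart of the matter is that two realisations `x`, `y` of an asymptotically free type with
`⟨h x, h y⟩ ≠ 0` have the same bounded closure, so that distinct classes `[x]` span orthogonal
subspaces (`CL.InterpretableHilbert.inner_eq_zero_of_bdd_ne`).  Asymptotic freeness puts `y` into
the bounded closure of `x`, and what is needed is transitivity of bounded closure
(`CL.bdd_subset_bdd`).  Suppose that `b ∈ bdd y` has infinitely many `δ`-separated conjugates `β n`
over `x`.  By compactness, in some elementary extension there are `Y n` such that `(β n, Y n)` has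
over `x` the type of `(b, y)` (`CL.exists_extension_conjugates`); by asymptotic freeness the `Y n`
accumulate at some realisation `y'` of `p`.  On the other hand, again by compactness, that `b` is
bounded over `y` is witnessed by a definable predicate of `y`: some number of `δ`-separated elements
cannot all come close to satisfying a suitable condition over `y` (`CL.exists_separation_pos`).
This predicate has the same value at `y'`, which is contradicted by the `β n` with `Y n` near `y'`.

Compactness is used in the form of ultrapowers of metric structures, with Łoś's theorem
(`CL.ultrapower_formula`, and `CL.Model.IsUlim.tendsto` for elements of imaginary sorts).  That the
auxiliary predicates are definable rests on the closure of the definable predicates under infima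
over possibly infinite tuples (`CL.IsDefinable.iInf`).

The rest is Hilbert space theory.  As `h` is isometric, realisations that are close are not
orthogonal, so the classes are uniformly open in `p(M)`: the stabiliser `K` of `[a]` is open, and
by density of an orbit the group permutes the classes transitively.  Hence `g ⊗ v ↦ π(g) v`
preserves inner products and has dense range in `H_p(M)`, and it intertwines the two
representations.
-/

noncomputable section

namespace CL

open Filter Topology

variable {L : Lang.{u}} {T : Theory L}

/-! ### Formulas: bounds, uniform continuity, renaming of variables -/

theorem abs_iSup_sub_iSup_le {ι : Sort*} [Nonempty ι] {f g : ι → ℝ} {B ε : ℝ}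
    (hf : ∀ i, |f i| ≤ B) (hg : ∀ i, |g i| ≤ B) (h : ∀ i, |f i - g i| ≤ ε) :
    |(⨆ i, f i) - ⨆ i, g i| ≤ ε := by
  have bf : BddAbove (Set.range f) := ⟨B, by rintro _ ⟨i, rfl⟩; exact (abs_le.1 (hf i)).2⟩
  have bg : BddAbove (Set.range g) := ⟨B, by rintro _ ⟨i, rfl⟩; exact (abs_le.1 (hg i)).2⟩
  rw [abs_le]
  constructor
  · have : (⨆ i, g i) ≤ (⨆ i, f i) + ε := ciSup_le fun i => by
      linarith [le_ciSup bf i, (abs_le.1 (h i)).1]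
    linarith
  · have : (⨆ i, f i) ≤ (⨆ i, g i) + ε := ciSup_le fun i => by
      linarith [le_ciSup bg i, (abs_le.1 (h i)).2]
    linarith

theorem abs_iInf_sub_iInf_le {ι : Sort*} [Nonempty ι] {f g : ι → ℝ} {B ε : ℝ}
    (hf : ∀ i, |f i| ≤ B) (hg : ∀ i, |g i| ≤ B) (h : ∀ i, |f i - g i| ≤ ε) :
    |(⨅ i, f i) - ⨅ i, g i| ≤ ε := by
  have bf : BddBelow (Set.range f) := ⟨-B, by rintro _ ⟨i, rfl⟩; exact (abs_le.1 (hf i)).1⟩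
  have bg : BddBelow (Set.range g) := ⟨-B, by rintro _ ⟨i, rfl⟩; exact (abs_le.1 (hg i)).1⟩
  rw [abs_le]
  constructor
  · have : (⨅ i, g i) - ε ≤ (⨅ i, f i) := le_ciInf fun i => by
      linarith [ciInf_le bg i, (abs_le.1 (h i)).1]
    linarith
  · have : (⨅ i, f i) - ε ≤ (⨅ i, g i) := le_ciInf fun i => by
      linarith [ciInf_le bf i, (abs_le.1 (h i)).2]
    linarith

theorem abs_iSup_le {ι : Sort*} [Nonempty ι] {f : ι → ℝ} {B : ℝ} (hf : ∀ i, |f i| ≤ B) :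
    |⨆ i, f i| ≤ B := by
  have h0 : (0 : ℝ) ≤ B := (abs_nonneg _).trans (hf (Classical.arbitrary ι))
  simpa using abs_iSup_sub_iSup_le (g := fun _ => (0 : ℝ)) hf (by simpa using h0)
    (by simpa using hf)

theorem abs_iInf_le {ι : Sort*} [Nonempty ι] {f : ι → ℝ} {B : ℝ} (hf : ∀ i, |f i| ≤ B) :
    |⨅ i, f i| ≤ B := by
  have h0 : (0 : ℝ) ≤ B := (abs_nonneg _).trans (hf (Classical.arbitrary ι))
  simpa using abs_iInf_sub_iInf_le (g := fun _ => (0 : ℝ)) hf (by simpa using h0)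
    (by simpa using hf)

/-- The bound does not depend on the structure. -/
theorem Formula.exists_bound {n : ℕ} {σ : Fin n → L.Srt} (φ : Formula L n σ) :
    ∃ B : ℝ, ∀ (M : Structure L) v, |φ.eval M v| ≤ B := by
  induction φ with
  | @dist n σ s t t' =>
    refine ⟨L.diam s, fun M v => ?_⟩
    rw [Formula.eval, abs_of_nonneg dist_nonneg]
    exact M.dist_le s _ _
  | rel R ts => exact ⟨L.relBound R, fun M v => M.rel_le R _⟩
  | conn m c φ ih =>
    choose B hB using ih
    have hK : IsCompact (Set.univ.pi fun i => Set.Icc (-B i) (B i)) :=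
      isCompact_univ_pi fun i => isCompact_Icc
    obtain ⟨C, hC⟩ := hK.exists_bound_of_continuousOn c.continuous.continuousOn
    exact ⟨C, fun M v => hC _ fun i _ => abs_le.1 (hB i M v)⟩
  | sup s φ ih =>
    obtain ⟨B, hB⟩ := ih
    exact ⟨B, fun M v => abs_iSup_le fun a => hB M _⟩
  | inf s φ ih =>
    obtain ⟨B, hB⟩ := ih
    exact ⟨B, fun M v => abs_iInf_le fun a => hB M _⟩

theorem Term.uniformContinuous (M : Structure L) {n : ℕ} {σ : Fin n → L.Srt} {s : L.Srt}
    (t : Term L σ s) : UniformContinuous fun v : (∀ k, M.carrier (σ k)) => t.eval M v := by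
  induction t with
  | var k => exact Pi.uniformContinuous_proj _ k
  | app f ts ih =>
    have h : UniformContinuous fun (v : ∀ k, M.carrier (σ k)) k => (ts k).eval M v :=
      uniformContinuous_pi.2 ih
    rw [Metric.uniformContinuous_iff] at h ⊢
    intro ε hε
    obtain ⟨δ, hδ, H⟩ := h (L.fnMod f (ε / 2)) (L.fnMod_pos f _ (by positivity))
    refine ⟨δ, hδ, fun v w hvw => ?_⟩
    have := M.fn_uc f (ε / 2) (by positivity) (fun k => (ts k).eval M v)
      (fun k => (ts k).eval M w)
      fun k => (dist_le_pi_dist (fun k => (ts k).eval M v) _ k).trans_lt (H hvw)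
    simp only [Term.eval]
    linarith

theorem dist_extend_le (M : Structure L) {n : ℕ} {σ : Fin n → L.Srt} {s : L.Srt}
    (a : M.carrier s) (v w : ∀ k, M.carrier (σ k)) :
    dist (extend M a v) (extend M a w) ≤ dist v w := by
  refine (dist_pi_le_iff dist_nonneg).2 fun k => ?_
  refine Fin.cases ?_ (fun i => ?_) k
  · exact (dist_self a).le.trans dist_nonneg
  · exact dist_le_pi_dist v w i

theorem Formula.uniformContinuous (M : Structure L) {n : ℕ} {σ : Fin n → L.Srt}
    (φ : Formula L n σ) : UniformContinuous fun v : (∀ k, M.carrier (σ k)) => φ.eval M v := by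
  induction φ with
  | dist t t' => exact (t.uniformContinuous M).dist (t'.uniformContinuous M)
  | rel R ts =>
    have h : UniformContinuous fun v k => (ts k).eval M v :=
      uniformContinuous_pi.2 fun k => (ts k).uniformContinuous M
    rw [Metric.uniformContinuous_iff] at h ⊢
    intro ε hε
    obtain ⟨δ, hδ, H⟩ := h (L.relMod R (ε / 2)) (L.relMod_pos R _ (by positivity))
    refine ⟨δ, hδ, fun v w hvw => ?_⟩
    have := M.rel_uc R (ε / 2) (by positivity) (fun k => (ts k).eval M v)
      (fun k => (ts k).eval M w)
      fun k => (dist_le_pi_dist (fun k => (ts k).eval M v) _ k).trans_lt (H hvw)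
    simp only [Formula.eval, Real.dist_eq]
    linarith
  | conn m c φ ih =>
    choose B hB using fun i => (φ i).exists_bound
    have hK : IsCompact (Set.univ.pi fun i => Set.Icc (-B i) (B i)) :=
      isCompact_univ_pi fun i => isCompact_Icc
    have h1 := hK.uniformContinuousOn_of_continuous c.continuous.continuousOn
    have h2 : UniformContinuous fun v i => (φ i).eval M v := uniformContinuous_pi.2 ih
    rw [Metric.uniformContinuousOn_iff] at h1
    rw [Metric.uniformContinuous_iff] at h2 ⊢
    intro ε hε
    obtain ⟨δ, hδ, H⟩ := h1 ε hε
    obtain ⟨δ', hδ', H'⟩ := h2 δ hδ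
    exact ⟨δ', hδ', fun v w hvw => H _ (fun i _ => abs_le.1 (hB i M v)) _
      (fun i _ => abs_le.1 (hB i M w)) (H' hvw)⟩
  | sup s φ ih =>
    obtain ⟨B, hB⟩ := φ.exists_bound
    rw [Metric.uniformContinuous_iff] at ih ⊢
    intro ε hε
    obtain ⟨δ, hδ, H⟩ := ih (ε / 2) (by positivity)
    refine ⟨δ, hδ, fun v w hvw => ?_⟩
    have : |(⨆ a, φ.eval M (extend M a v)) - ⨆ a, φ.eval M (extend M a w)| ≤ ε / 2 :=
      abs_iSup_sub_iSup_le (fun a => hB M _) (fun a => hB M _)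
        fun a => (H ((dist_extend_le M a v w).trans_lt hvw)).le
    simp only [Formula.eval, Real.dist_eq]
    linarith
  | inf s φ ih =>
    obtain ⟨B, hB⟩ := φ.exists_bound
    rw [Metric.uniformContinuous_iff] at ih ⊢
    intro ε hε
    obtain ⟨δ, hδ, H⟩ := ih (ε / 2) (by positivity)
    refine ⟨δ, hδ, fun v w hvw => ?_⟩
    have : |(⨅ a, φ.eval M (extend M a v)) - ⨅ a, φ.eval M (extend M a w)| ≤ ε / 2 :=
      abs_iInf_sub_iInf_le (fun a => hB M _) (fun a => hB M _)
        fun a => (H ((dist_extend_le M a v w).trans_lt hvw)).le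
    simp only [Formula.eval, Real.dist_eq]
    linarith

/-- Variables of a term may be renamed and identified.  The equations `h` between sorts are
propositional, so the values are transported along them. -/
theorem Term.exists_rename {n m : ℕ} {σ : Fin n → L.Srt} {τ : Fin m → L.Srt} (r : Fin n → Fin m)
    (h : ∀ k, τ (r k) = σ k) {s : L.Srt} (t : Term L σ s) :
    ∃ t' : Term L τ s, ∀ (M : Structure L) v, t'.eval M v = t.eval M fun k => h k ▸ v (r k) := by
  induction t with
  | var k =>
    have key : ∀ {s s' : L.Srt} (e : s = s') (t : Term L τ s), ∃ t' : Term L τ s',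
        ∀ (M : Structure L) v, t'.eval M v = e ▸ t.eval M v := by
      rintro s _ rfl t
      exact ⟨t, fun _ _ => rfl⟩
    exact key (h k) (.var (r k))
  | app f ts ih =>
    choose ts' h' using ih
    exact ⟨.app f ts', fun M v => by simp only [Term.eval, h']⟩

/-- Variables of a formula may be renamed and identified, as in `Term.exists_rename`. -/
theorem Formula.exists_rename {n : ℕ} {σ : Fin n → L.Srt} (φ : Formula L n σ) :
    ∀ {m : ℕ} {τ : Fin m → L.Srt} (r : Fin n → Fin m) (h : ∀ k, τ (r k) = σ k),
    ∃ ψ : Formula L m τ, ∀ (M : Structure L) v, ψ.eval M v = φ.eval M fun k => h k ▸ v (r k) := by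
  -- Under a quantifier the renaming fixes the new variable `0` and shifts all others.
  have key : ∀ {n m : ℕ} {σ : Fin n → L.Srt} {τ : Fin m → L.Srt} (r : Fin n → Fin m)
      (h : ∀ k, τ (r k) = σ k) (s : L.Srt), ∃ (r' : Fin (n + 1) → Fin (m + 1))
      (h' : ∀ k, Fin.cons (α := fun _ => L.Srt) s τ (r' k) =
        Fin.cons (α := fun _ => L.Srt) s σ k),
      ∀ (M : Structure L) (a : M.carrier s) v, extend M a (fun k => h k ▸ v (r k)) =
        fun k => h' k ▸ extend M a v (r' k) := by
    intro n m σ τ r h s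
    refine ⟨Fin.cases 0 fun k => (r k).succ, Fin.cases rfl h, fun M a v => ?_⟩
    funext k
    refine Fin.cases ?_ (fun i => ?_) k <;> rfl
  induction φ with
  | dist t t' =>
    intro m τ r h
    obtain ⟨u, hu⟩ := t.exists_rename r h
    obtain ⟨u', hu'⟩ := t'.exists_rename r h
    exact ⟨.dist u u', fun M v => by simp only [Formula.eval, hu, hu']⟩
  | rel R ts =>
    intro m τ r h
    choose us hus using fun k => (ts k).exists_rename r h
    exact ⟨.rel R us, fun M v => by simp only [Formula.eval, hus]⟩
  | conn l c φ ih =>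
    intro m τ r h
    choose ψ hψ using fun k => ih k r h
    exact ⟨.conn l c ψ, fun M v => by simp only [Formula.eval, hψ]⟩
  | sup s φ ih =>
    intro m τ r h
    obtain ⟨r', h', H⟩ := key r h s
    obtain ⟨ψ, hψ⟩ := ih r' h'
    exact ⟨.sup s ψ, fun M v => by simp only [Formula.eval, hψ, H]⟩
  | inf s φ ih =>
    intro m τ r h
    obtain ⟨r', h', H⟩ := key r h s
    obtain ⟨ψ, hψ⟩ := ih r' h'
    exact ⟨.inf s ψ, fun M v => by simp only [Formula.eval, hψ, H]⟩

/-! ### Closure properties of definable predicates -/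

theorem transport_apply (M : Structure L) {α : Type*} {σ : α → L.Srt}
    (x : ∀ a, M.carrier (σ a)) {a b : α} (hab : a = b) (h : σ a = σ b) :
    (h ▸ x a : M.carrier (σ b)) = x b := by
  subst hab
  rfl

theorem Formula.exists_reindex {α : Type*} {σ : α → L.Srt} {n m : ℕ} {ρ : Fin n → α}
    {ρ' : Fin m → α} (φ : Formula L n fun k => σ (ρ k)) (r : Fin n → Fin m)
    (h : ∀ k, ρ' (r k) = ρ k) :
    ∃ ψ : Formula L m fun k => σ (ρ' k), ∀ (M : Structure L) (x : ∀ a, M.carrier (σ a)),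
      ψ.eval M (fun k => x (ρ' k)) = φ.eval M fun k => x (ρ k) := by
  obtain ⟨ψ, hψ⟩ := φ.exists_rename (τ := fun k => σ (ρ' k)) r fun k => congrArg σ (h k)
  refine ⟨ψ, fun M x => ?_⟩
  rw [hψ]
  congr 1
  funext k
  exact transport_apply M x (h k) _

open Classical in
/-- The infimum over one variable `c` of a formula in the variables `ρ k` is a formula in those of
the variables that differ from `c`. -/
theorem Formula.exists_iInf_update {α : Type*} {σ : α → L.Srt} {n : ℕ} {ρ : Fin n → α}
    (φ : Formula L n fun k => σ (ρ k)) (c : α) :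
    ∃ (m : ℕ) (ρ' : Fin m → α) (ψ : Formula L m fun k => σ (ρ' k)),
      (∀ k, ρ' k ≠ c ∧ ρ' k ∈ Set.range ρ) ∧
      ∀ (M : Structure L) (x : ∀ a, M.carrier (σ a)), ψ.eval M (fun k => x (ρ' k)) =
        ⨅ d, φ.eval M fun k => Function.update x c d (ρ k) := by
  let e := Fintype.equivFin {k // ρ k ≠ c}
  let ρ' : Fin _ → α := fun k => ρ (e.symm k).1
  let r : Fin n → Fin (Fintype.card {k // ρ k ≠ c} + 1) := fun k =>
    if h : ρ k ≠ c then (e ⟨k, h⟩).succ else 0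
  have hr : ∀ k, (r k = 0 ∧ ρ k = c) ∨ ∃ i, r k = Fin.succ i ∧ ρ k = ρ' i ∧ ρ k ≠ c := by
    intro k
    by_cases h : ρ k = c
    · exact Or.inl ⟨by simp [r, h], h⟩
    · exact Or.inr ⟨e ⟨k, h⟩, by simp [r, h], by simp [ρ'], h⟩
  have hs : ∀ k, Fin.cons (α := fun _ => L.Srt) (σ c) (fun k => σ (ρ' k)) (r k) = σ (ρ k) := by
    intro k
    rcases hr k with ⟨h, h'⟩ | ⟨i, h, h', -⟩
    · rw [h, h']; rfl
    · rw [h, h']; rfl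
  obtain ⟨ψ, hψ⟩ := φ.exists_rename r hs
  refine ⟨_, ρ', .inf _ ψ, fun k => ⟨(e.symm k).2, _, rfl⟩, fun M x => ?_⟩
  rw [Formula.eval]
  refine iInf_congr fun d => ?_
  rw [hψ]
  congr 1
  have key : ∀ (j : Fin (Fintype.card {k // ρ k ≠ c} + 1)) (b : α)
      (h : Fin.cons (α := fun _ => L.Srt) (σ c) (fun k => σ (ρ' k)) j = σ b),
      ((j = 0 ∧ b = c) ∨ ∃ i, j = Fin.succ i ∧ b = ρ' i ∧ b ≠ c) →
      (h ▸ extend M d (fun k => x (ρ' k)) j : M.carrier (σ b)) = Function.update x c d b := by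
    rintro j b h (⟨rfl, rfl⟩ | ⟨i, rfl, rfl, hb⟩)
    · rw [Function.update_self]; rfl
    · rw [Function.update_of_ne hb]; rfl
  funext k
  exact key _ _ _ (hr k)

theorem iInf_eq_of_forall_exists {ι ι' : Sort*} {f : ι → ℝ} {g : ι' → ℝ}
    (h : ∀ i, ∃ j, g j = f i) (h' : ∀ j, ∃ i, f i = g j) : ⨅ i, f i = ⨅ j, g j := by
  refine congrArg sInf (Set.Subset.antisymm ?_ ?_)
  · rintro _ ⟨i, rfl⟩
    exact h i
  · rintro _ ⟨j, rfl⟩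
    exact h' j

/-- The infimum over the variables in the list `l`: the values `w` range over all valuations that
agree with `x` off `l`. -/
theorem Formula.exists_iInf_list {α : Type*} {σ : α → L.Srt} {n : ℕ} {ρ : Fin n → α}
    (φ : Formula L n fun k => σ (ρ k)) (l : List α) :
    ∃ (m : ℕ) (ρ' : Fin m → α) (ψ : Formula L m fun k => σ (ρ' k)),
      (∀ k, ρ' k ∉ l ∧ ρ' k ∈ Set.range ρ) ∧
      ∀ (M : Structure L) (x : ∀ a, M.carrier (σ a)), ψ.eval M (fun k => x (ρ' k)) =
        ⨅ w : {w : ∀ a, M.carrier (σ a) // ∀ a, a ∉ l → w a = x a},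
          φ.eval M fun k => w.1 (ρ k) := by
  classical
  induction l with
  | nil =>
    refine ⟨n, ρ, φ, fun k => ⟨by simp, k, rfl⟩, fun M x => ?_⟩
    have hw : ∀ w : {w : ∀ a, M.carrier (σ a) // ∀ a, a ∉ ([] : List α) → w a = x a},
        w.1 = x := fun w => funext fun a => w.2 a (by simp)
    have : Nonempty {w : ∀ a, M.carrier (σ a) // ∀ a, a ∉ ([] : List α) → w a = x a} :=
      ⟨⟨x, fun _ _ => rfl⟩⟩
    refine Eq.trans ?_ (iInf_congr fun w =>
      congrArg (fun w : (∀ a, M.carrier (σ a)) => φ.eval M fun k => w (ρ k)) (hw w).symm)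
    exact ciInf_const.symm
  | cons c l ih =>
    obtain ⟨m, ρ', ψ, hρ', hψ⟩ := ih
    obtain ⟨m', ρ'', χ, hρ'', hχ⟩ := ψ.exists_iInf_update c
    refine ⟨m', ρ'', χ, fun k => ?_, fun M x => ?_⟩
    · obtain ⟨h1, k', h2⟩ := hρ'' k
      refine ⟨?_, h2 ▸ (hρ' k').2⟩
      rw [List.mem_cons, not_or]
      exact ⟨h1, h2 ▸ (hρ' k').1⟩
    · obtain ⟨B, hB⟩ := φ.exists_bound
      have bdd : ∀ {ι : Type u} (f : ι → ∀ a, M.carrier (σ a)),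
          BddBelow (Set.range fun i => φ.eval M fun k => f i (ρ k)) := fun f =>
        ⟨-B, by rintro _ ⟨i, rfl⟩; exact (abs_le.1 (hB M _)).1⟩
      have bdd' : ∀ {ι : Type u} (f : ι → ∀ a, M.carrier (σ a)),
          BddBelow (Set.range fun i => ψ.eval M fun k => f i (ρ' k)) := fun f => by
        obtain ⟨B', hB'⟩ := ψ.exists_bound
        exact ⟨-B', by rintro _ ⟨i, rfl⟩; exact (abs_le.1 (hB' M _)).1⟩
      have h0 : ∀ (l : List α) (x : ∀ a, M.carrier (σ a)),
          Nonempty {w : ∀ a, M.carrier (σ a) // ∀ a, a ∉ l → w a = x a} :=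
        fun _ x => ⟨⟨x, fun _ _ => rfl⟩⟩
      rw [hχ]
      apply le_antisymm
      · refine le_ciInf fun w => ?_
        refine (ciInf_le (bdd' _) (w.1 c)).trans ?_
        rw [hψ]
        refine ciInf_le_of_le ⟨-B, by rintro _ ⟨i, rfl⟩; exact (abs_le.1 (hB M _)).1⟩
          ⟨w.1, fun a ha => ?_⟩ le_rfl
        by_cases hc : a = c
        · subst hc; rw [Function.update_self]
        · rw [Function.update_of_ne hc, w.2 a (by simp [hc, ha])]
      · refine le_ciInf fun d => ?_
        rw [hψ]
        refine le_ciInf fun w => ?_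
        refine ciInf_le_of_le ⟨-B, by rintro _ ⟨i, rfl⟩; exact (abs_le.1 (hB M _)).1⟩
          ⟨w.1, fun a ha => ?_⟩ le_rfl
        rw [List.mem_cons, not_or] at ha
        rw [w.2 a ha.2, Function.update_of_ne ha.1]

namespace IsDefinable

variable {α β : Type} {σ : α → L.Srt} {τ : β → L.Srt}
  {F G : ∀ M : Model T, (∀ a, M.str.carrier (σ a)) → ℝ}

/-- The bound does not depend on the model. -/
theorem exists_bound (hF : IsDefinable T σ F) : ∃ B : ℝ, ∀ M x, |F M x| ≤ B := by
  obtain ⟨n, ρ, φ, h⟩ := hF 1 one_pos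
  obtain ⟨B, hB⟩ := φ.exists_bound
  refine ⟨1 + B, fun M x => ?_⟩
  have h1 := h M x
  have h2 := hB M.str fun k => x (ρ k)
  rw [abs_le] at *
  constructor <;> linarith [h1.1, h1.2, h2.1, h2.2]

theorem const (r : ℝ) : IsDefinable T σ fun _ _ => r := fun ε hε =>
  ⟨0, Fin.elim0, .conn 0 (.const _ r) fun k => k.elim0, fun M x => by
    simpa [Formula.eval] using hε.le⟩

theorem comp (hF : IsDefinable T σ F) {c : ℝ → ℝ} (hc : LipschitzWith 1 c) :
    IsDefinable T σ fun M x => c (F M x) := fun ε hε => by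
  obtain ⟨n, ρ, φ, h⟩ := hF ε hε
  refine ⟨n, ρ, .conn 1 ⟨fun v => c (v 0), hc.continuous.comp (continuous_apply 0)⟩
    fun _ => φ, fun M x => ?_⟩
  have := hc.dist_le_mul (F M x) (φ.eval M.str fun k => x (ρ k))
  rw [NNReal.coe_one, one_mul, Real.dist_eq, Real.dist_eq] at this
  exact this.trans (h M x)

theorem add (hF : IsDefinable T σ F) (hG : IsDefinable T σ G) :
    IsDefinable T σ fun M x => F M x + G M x := fun ε hε => by
  obtain ⟨n, ρ, φ, h⟩ := hF (ε / 2) (by positivity)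
  obtain ⟨n', ρ', φ', h'⟩ := hG (ε / 2) (by positivity)
  obtain ⟨ψ, hψ⟩ := φ.exists_reindex (σ := σ) (ρ' := Fin.append ρ ρ') (Fin.castAdd n')
    fun k => by simp
  obtain ⟨ψ', hψ'⟩ := φ'.exists_reindex (σ := σ) (ρ' := Fin.append ρ ρ') (Fin.natAdd n)
    fun k => by simp
  refine ⟨_, Fin.append ρ ρ', .conn 2 ⟨fun v => v 0 + v 1, by fun_prop⟩ ![ψ, ψ'],
    fun M x => ?_⟩
  have h1 := h M x
  have h2 := h' M x
  rw [← hψ] at h1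
  rw [← hψ'] at h2
  simp only [Formula.eval, ContinuousMap.coe_mk, Matrix.cons_val_zero, Matrix.cons_val_one]
  rw [abs_le] at *
  constructor <;> linarith [h1.1, h1.2, h2.1, h2.2]

theorem sum {κ : Type*} (s : Finset κ) {F : κ → ∀ M : Model T, (∀ a, M.str.carrier (σ a)) → ℝ}
    (hF : ∀ k, IsDefinable T σ (F k)) : IsDefinable T σ fun M x => ∑ k ∈ s, F k M x := by
  classical
  induction s using Finset.induction_on with
  | empty => simpa using const 0
  | insert k s hk ih => simpa [Finset.sum_insert hk] using (hF k).add ih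

/-- Substitution of variables.  The equations `h` between sorts are propositional, so the values are
transported along them. -/
theorem reindex {G : ∀ M : Model T, (∀ b, M.str.carrier (τ b)) → ℝ} (hG : IsDefinable T τ G)
    (e : β → α) (h : ∀ b, σ (e b) = τ b) :
    IsDefinable T σ fun M x => G M fun b => h b ▸ x (e b) := fun ε hε => by
  obtain ⟨n, ρ, φ, H⟩ := hG ε hε
  obtain ⟨ψ, hψ⟩ := φ.exists_rename (τ := fun k => σ (e (ρ k))) id fun k => h (ρ k)
  refine ⟨n, fun k => e (ρ k), ψ, fun M x => ?_⟩
  rw [hψ]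
  exact H M _

/-- Infima over tuples of variables, infinite ones included, preserve definability: every
approximating formula mentions only finitely many of the variables. -/
theorem iInf {F : ∀ M : Model T, (∀ a, M.str.carrier (σ a)) → (∀ b, M.str.carrier (τ b)) → ℝ}
    (hF : IsDefinable T (Sum.elim σ τ) fun M x =>
      F M (fun a => x (Sum.inl a)) fun b => x (Sum.inr b)) :
    IsDefinable T σ fun M x => ⨅ t, F M x t := fun ε hε => by
  classical
  obtain ⟨n, ρ, φ, H⟩ := hF ε hε
  obtain ⟨m, ρ', ψ, hρ', hψ⟩ := φ.exists_iInf_list (σ := Sum.elim σ τ)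
    ((List.ofFn ρ).filter fun c => c.isRight)
  -- All variables of `ψ` are free ones, because it has only variables of `φ`.
  have hl : ∀ k, ∃ a, ρ' k = Sum.inl a := by
    intro k
    obtain ⟨h1, k', h2⟩ := hρ' k
    rw [← h2] at h1 ⊢
    rcases h : ρ k' with a | b
    · exact ⟨a, rfl⟩
    · exact absurd (List.mem_filter.2 ⟨List.mem_ofFn.2 ⟨k', rfl⟩, by rw [h]; rfl⟩) h1
  choose e he using hl
  obtain rfl : ρ' = fun k => Sum.inl (e k) := funext he
  refine ⟨m, e, ψ, fun M x => ?_⟩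
  obtain ⟨B, hB⟩ := φ.exists_bound
  let join (t : ∀ b, M.str.carrier (τ b)) (c : α ⊕ β) : M.str.carrier (Sum.elim σ τ c) :=
    Sum.rec (motive := fun c => M.str.carrier (Sum.elim σ τ c)) x t c
  have hφ : ∀ t, |F M x t - φ.eval M.str fun k => join t (ρ k)| ≤ ε := fun t => H M (join t)
  have hF' : ∀ t, |F M x t| ≤ B + ε := fun t => by
    have h1 := hφ t
    have h2 := hB M.str fun k => join t (ρ k)
    rw [abs_le] at *
    constructor <;> linarith [h1.1, h1.2, h2.1, h2.2]
  let t₀ : ∀ b, M.str.carrier (τ b) := fun b => Classical.arbitrary _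
  have h1 := hψ M.str (join t₀)
  have h2 : (⨅ t, φ.eval M.str fun k => join t (ρ k)) = ψ.eval M.str fun k => x (e k) := by
    refine Eq.trans ?_ h1.symm
    refine iInf_eq_of_forall_exists (fun t => ?_) fun w => ?_
    · refine ⟨⟨fun c => if c ∈ (List.ofFn ρ).filter (fun c => c.isRight) then join t c
        else join t₀ c, fun a ha => if_neg ha⟩, ?_⟩
      congr 1
      funext k
      dsimp only
      split_ifs with hk
      · rfl
      · rcases h : ρ k with a | b
        · rfl
        · exact absurd (List.mem_filter.2 ⟨List.mem_ofFn.2 ⟨k, rfl⟩, by rw [h]; rfl⟩) hk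
    · refine ⟨fun b => w.1 (Sum.inr b), ?_⟩
      congr 1
      funext k
      rcases ρ k with a | b
      · exact (w.2 (Sum.inl a) (by simp)).symm
      · rfl
  have h3 := abs_iInf_sub_iInf_le hF' (fun t => (hB _ _).trans (by linarith)) hφ
  rw [h2] at h3
  exact h3

end IsDefinable

/-! ### Definable predicates on imaginary sorts -/

theorem lipschitzWith_abs_sub (r : ℝ) : LipschitzWith 1 fun s : ℝ => |s - r| :=
  LipschitzWith.of_dist_le_mul fun a b => by
    rw [NNReal.coe_one, one_mul, Real.dist_eq, Real.dist_eq]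
    exact (abs_abs_sub_abs_le _ _).trans (by rw [sub_sub_sub_cancel_right])

theorem lipschitzWith_max_sub (δ : ℝ) : LipschitzWith 1 fun s : ℝ => max (δ - s) 0 :=
  LipschitzWith.of_dist_le_mul fun a b => by
    rw [NNReal.coe_one, one_mul, Real.dist_eq, Real.dist_eq]
    refine (abs_max_sub_max_le_abs _ _ _).trans ?_
    rw [sub_sub_sub_cancel_left, abs_sub_comm]

namespace ImagSort

theorem dist_rep (E : ImagSort T) {M : Model T} (x y : ∀ i, M.str.carrier (E.srt i)) :
    dist (E.rep x) (E.rep y) = E.d M x y :=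
  UniformSpace.Completion.dist_eq _ _

theorem denseRange_rep (E : ImagSort T) (M : Model T) : DenseRange (E.rep (M := M)) := by
  have h : DenseRange ((↑) : E.Pre M → E.Elt M) := UniformSpace.Completion.denseRange_coe
  refine h.mono ?_
  rintro _ ⟨x, rfl⟩
  exact ⟨x.val, rfl⟩

theorem exists_dist_rep_lt (E : ImagSort T) {M : Model T} (z : E.Elt M) {ε : ℝ} (hε : 0 < ε) :
    ∃ x, dist z (E.rep x) < ε :=
  (E.denseRange_rep M).exists_dist_lt z hε

end ImagSort

namespace ImagPred₂

variable {E S S' : ImagSort T}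

/-- A closed condition on definable predicates holds everywhere if it holds on representatives. -/
theorem rep_induction {M : Model T} {P : E.Elt M → S.Elt M → Prop}
    (hP : IsClosed {x : E.Elt M × S.Elt M | P x.1 x.2})
    (h : ∀ x y, P (E.rep x) (S.rep y)) (x : E.Elt M) (y : S.Elt M) : P x y :=
  UniformSpace.Completion.induction_on₂ x y hP fun a b => h a.val b.val

/-- The bound does not depend on the model. -/
theorem exists_bound (f : ImagPred₂ E S) : ∃ B : ℝ, ∀ M x y, |f.val M x y| ≤ B := by
  obtain ⟨B, hB⟩ := f.definable.exists_bound
  refine ⟨B, fun M => rep_induction (isClosed_le (f.continuous M).abs continuous_const)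
    fun x y => ?_⟩
  exact hB M fun c => Sum.rec (motive := fun c => M.str.carrier (Sum.elim E.srt S.srt c)) x y c

/-- The zero predicate. -/
def zero : ImagPred₂ E S where
  val _ _ _ := 0
  definable := IsDefinable.const 0
  uc ε hε := ⟨1, one_pos, fun _ _ _ _ _ _ _ => by simpa using hε.le⟩

/-- The sum of two definable predicates. -/
def add (f g : ImagPred₂ E S) : ImagPred₂ E S where
  val M x y := f.val M x y + g.val M x y
  definable := f.definable.add g.definable
  uc ε hε := by
    obtain ⟨δ, hδ, h⟩ := f.uc (ε / 2) (by positivity)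
    obtain ⟨δ', hδ', h'⟩ := g.uc (ε / 2) (by positivity)
    refine ⟨min δ δ', lt_min hδ hδ', fun M x y x' y' hx hy => ?_⟩
    have h1 := h M x y x' y' (hx.trans_le (min_le_left _ _)) (hy.trans_le (min_le_left _ _))
    have h2 := h' M x y x' y' (hx.trans_le (min_le_right _ _)) (hy.trans_le (min_le_right _ _))
    rw [abs_le] at *
    constructor <;> linarith [h1.1, h1.2, h2.1, h2.2]

/-- The predicate `|f - r|`. -/
def absSub (f : ImagPred₂ E S) (r : ℝ) : ImagPred₂ E S where
  val M x y := |f.val M x y - r|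
  definable := f.definable.comp (lipschitzWith_abs_sub r)
  uc ε hε := by
    obtain ⟨δ, hδ, h⟩ := f.uc ε hε
    refine ⟨δ, hδ, fun M x y x' y' hx hy => ?_⟩
    refine le_trans ?_ (h M x y x' y' hx hy)
    simpa [Real.dist_eq] using (lipschitzWith_abs_sub r).dist_le_mul (f.val M x x') (f.val M y y')

/-- A definable predicate of the second variable only. -/
def ofRight (f : ImagPred S) : ImagPred₂ E S where
  val M _ y := f.val M y
  definable := f.definable.reindex (σ := Sum.elim E.srt S.srt) Sum.inr fun _ => rfl
  uc ε hε := by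
    obtain ⟨δ, hδ, h⟩ := f.uc ε hε
    exact ⟨δ, hδ, fun M x y x' y' _ hy => h M x' y' hy⟩

/-- The metric of an imaginary sort. -/
def dist : ImagPred₂ E E where
  val _ x y := Dist.dist x y
  definable ε hε := by
    obtain ⟨n, ρ, φ, h⟩ := E.definable ε hε
    exact ⟨n, ρ, φ, fun M x =>
      (congrArg (fun r => |r - _|) (E.dist_rep _ _)).trans_le (h M x)⟩
  uc ε hε := by
    refine ⟨ε / 2, by positivity, fun M x y x' y' hx hy => ?_⟩
    have := dist_dist_dist_le x x' y y'
    rw [Real.dist_eq] at this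
    linarith

/-- Finitely many conditions `f j = r j` can be expressed by a single definable predicate. -/
theorem exists_conj {κ : Type*} (s : Finset κ) (f : κ → ImagPred₂ E S) (r : κ → ℝ) :
    ∃ θ : ImagPred₂ E S, (∀ M x y, 0 ≤ θ.val M x y) ∧
      (∀ j ∈ s, ∀ M x y, |(f j).val M x y - r j| ≤ θ.val M x y) ∧
      ∀ M x y, (∀ j ∈ s, (f j).val M x y = r j) → θ.val M x y = 0 := by
  classical
  induction s using Finset.induction_on with
  | empty => exact ⟨zero, fun _ _ _ => le_rfl, by simp, fun _ _ _ _ => rfl⟩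
  | insert k s hk ih =>
    obtain ⟨θ, h0, h1, h2⟩ := ih
    refine ⟨((f k).absSub (r k)).add θ, fun M x y => ?_, fun j hj M x y => ?_,
      fun M x y h => ?_⟩
    · exact add_nonneg (abs_nonneg _) (h0 M x y)
    · rcases Finset.mem_insert.1 hj with rfl | hj
      · exact le_add_of_nonneg_right (h0 M x y)
      · exact (h1 j hj M x y).trans (le_add_of_nonneg_left (abs_nonneg _))
    · have e1 : |(f k).val M x y - r k| = 0 := by
        rw [h k (Finset.mem_insert_self _ _), sub_self, abs_zero]
      have e2 := h2 M x y fun j hj => h j (Finset.mem_insert_of_mem hj)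
      exact (congrArg₂ (· + ·) e1 e2).trans (add_zero 0)

/-- The predicate `(b, x) ↦ inf_y (f(b, y) + g(x, y))`, which says how nearly the conditions
`f(b, y) = 0` and `g(x, y) = 0` have a common solution `y`. -/
def infAdd (f : ImagPred₂ E S) (g : ImagPred₂ S' S) : ImagPred₂ E S' where
  val M b x := ⨅ y : (∀ i, M.str.carrier (S.srt i)), (f.val M b (S.rep y) + g.val M x (S.rep y))
  definable := by
    refine IsDefinable.iInf (F := fun M (x : ∀ a, M.str.carrier (Sum.elim E.srt S'.srt a)) y =>
      f.val M (E.rep fun i => x (Sum.inl i)) (S.rep y) +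
        g.val M (S'.rep fun i => x (Sum.inr i)) (S.rep y)) ?_
    exact (f.definable.reindex (σ := Sum.elim (Sum.elim E.srt S'.srt) S.srt)
        (Sum.elim (fun i => Sum.inl (Sum.inl i)) Sum.inr) (by rintro (_ | _) <;> rfl)).add
      (g.definable.reindex (σ := Sum.elim (Sum.elim E.srt S'.srt) S.srt)
        (Sum.elim (fun i => Sum.inl (Sum.inr i)) Sum.inr) (by rintro (_ | _) <;> rfl))
  uc ε hε := by
    obtain ⟨B, hB⟩ := (f : ImagPred₂ E S).exists_bound
    obtain ⟨B', hB'⟩ := g.exists_bound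
    obtain ⟨δ, hδ, h⟩ := f.uc (ε / 2) (by positivity)
    obtain ⟨δ', hδ', h'⟩ := g.uc (ε / 2) (by positivity)
    refine ⟨min δ δ', lt_min hδ hδ', fun M x y x' y' hx hy => ?_⟩
    refine abs_iInf_sub_iInf_le (B := B + B')
      (fun z => (abs_add_le _ _).trans (add_le_add (hB _ _ _) (hB' _ _ _)))
      (fun z => (abs_add_le _ _).trans (add_le_add (hB _ _ _) (hB' _ _ _))) fun z => ?_
    have h1 := h M x y (S.rep z) (S.rep z) (hx.trans_le (min_le_left _ _)) (by simpa using hδ)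
    have h2 := h' M x' y' (S.rep z) (S.rep z) (hy.trans_le (min_le_right _ _))
      (by simpa using hδ')
    rw [abs_le] at *
    constructor <;> linarith [h1.1, h1.2, h2.1, h2.2]

/-- The predicate `y ↦ inf_t (∑ i, θ(t i, y) + ∑ i ≠ j, (δ - d(t i, t j))⁺)`, over `k`-tuples `t`.
It is positive at `y` when no `k` elements that are pairwise `δ`-separated nearly satisfy
`θ(·, y) = 0`. -/
def separation (θ : ImagPred₂ E S) (k : ℕ) (δ : ℝ) : ImagPred S where
  val M y := ⨅ t : (∀ c : Fin k × E.ι, M.str.carrier (E.srt c.2)),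
    ((∑ i, θ.val M (E.rep fun a => t (i, a)) y) +
      ∑ q : {q : Fin k × Fin k // q.1 ≠ q.2},
        max (δ - Dist.dist (E.rep fun a => t (q.1.1, a)) (E.rep fun a => t (q.1.2, a))) 0)
  definable := by
    refine IsDefinable.iInf (τ := fun c : Fin k × E.ι => E.srt c.2)
      (F := fun M (y : ∀ a, M.str.carrier (S.srt a)) t =>
      ((∑ i, θ.val M (E.rep fun a => t (i, a)) (S.rep y)) +
      ∑ q : {q : Fin k × Fin k // q.1 ≠ q.2},
        max (δ - Dist.dist (E.rep fun a => t (q.1.1, a)) (E.rep fun a => t (q.1.2, a))) 0)) ?_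
    refine (IsDefinable.sum Finset.univ fun i => ?_).add (IsDefinable.sum Finset.univ fun q => ?_)
    · exact θ.definable.reindex (σ := Sum.elim S.srt fun c : Fin k × E.ι => E.srt c.2)
        (Sum.elim (fun a => Sum.inr (i, a)) Sum.inl) (by rintro (_ | _) <;> rfl)
    · exact ((dist (E := E)).definable.reindex
        (σ := Sum.elim S.srt fun c : Fin k × E.ι => E.srt c.2)
        (Sum.elim (fun a => Sum.inr (q.1.1, a)) fun a => Sum.inr (q.1.2, a))
        (by rintro (_ | _) <;> rfl)).comp (lipschitzWith_max_sub δ)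
  uc ε hε := by
    obtain ⟨B, hB⟩ := θ.exists_bound
    obtain ⟨δ', hδ', h⟩ := θ.uc (ε / (k + 1)) (by positivity)
    obtain ⟨B', hB'⟩ := (dist (E := E)).exists_bound
    refine ⟨δ', hδ', fun M x y hxy => ?_⟩
    have bound : ∀ (y : S.Elt M) (t : ∀ c : Fin k × E.ι, M.str.carrier (E.srt c.2)),
        |(∑ i, θ.val M (E.rep fun a => t (i, a)) y) +
          ∑ q : {q : Fin k × Fin k // q.1 ≠ q.2},
          max (δ - Dist.dist (E.rep fun a => t (q.1.1, a)) (E.rep fun a => t (q.1.2, a))) 0| ≤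
        (∑ _i : Fin k, B) + ∑ _q : {q : Fin k × Fin k // q.1 ≠ q.2}, |δ| := by
      intro y t
      refine (abs_add_le _ _).trans (add_le_add ?_ ?_)
      · exact (Finset.abs_sum_le_sum_abs _ _).trans (Finset.sum_le_sum fun i _ => hB _ _ _)
      · refine (Finset.abs_sum_le_sum_abs _ _).trans (Finset.sum_le_sum fun q _ => ?_)
        rw [abs_of_nonneg (le_max_right _ _)]
        refine max_le ?_ (abs_nonneg _)
        linarith [le_abs_self δ, dist_nonneg (x := E.rep fun a => t (q.1.1, a))
          (y := E.rep fun a => t (q.1.2, a))]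
    refine abs_iInf_sub_iInf_le (bound x) (bound y) fun t => ?_
    rw [add_sub_add_right_eq_sub, ← Finset.sum_sub_distrib]
    refine (Finset.abs_sum_le_sum_abs _ _).trans ?_
    refine (Finset.sum_le_sum fun i _ => h M _ _ _ _ (by simpa using hδ') hxy).trans ?_
    rw [Finset.sum_const, Finset.card_univ, Fintype.card_fin, nsmul_eq_mul, mul_div_assoc',
      div_le_iff₀ (by positivity)]
    nlinarith

/-- Although the definable predicates form a large type, those that are needed to separate points
are indexed by the small type of formulas: there is a uniformly dense family with an index type in
the universe of the language. -/
theorem exists_dense_family (E S : ImagSort T) : ∃ (J : Type u) (D : J → ImagPred₂ E S),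
    ∀ (f : ImagPred₂ E S) (ε : ℝ), 0 < ε →
      ∃ j, ∀ M x y, |f.val M x y - (D j).val M x y| ≤ ε := by
  classical
  let Φ := (n : ℕ) × (ρ : Fin n → E.ι ⊕ S.ι) × Formula L n fun k => Sum.elim E.srt S.srt (ρ k)
  let near (c : Φ × ℕ) (f : ImagPred₂ E S) : Prop :=
    ∀ (M : Model T) (x : ∀ a, M.str.carrier (Sum.elim E.srt S.srt a)),
      |f.val M (E.rep fun i => x (Sum.inl i)) (S.rep fun i => x (Sum.inr i)) -
        c.1.2.2.eval M.str fun k => x (c.1.2.1 k)| ≤ 1 / (c.2 + 1)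
  let D (c : Φ × ℕ) : ImagPred₂ E S := if h : ∃ f, near c f then h.choose else zero
  refine ⟨Φ × ℕ, D, fun f ε hε => ?_⟩
  obtain ⟨m, hm⟩ := exists_nat_one_div_lt (half_pos hε)
  obtain ⟨n, ρ, φ, h⟩ := f.definable (1 / (m + 1)) (by positivity)
  have hf : ∃ f, near (⟨n, ρ, φ⟩, m) f := ⟨f, h⟩
  have hD : D (⟨n, ρ, φ⟩, m) = hf.choose := dif_pos hf
  refine ⟨(⟨n, ρ, φ⟩, m), fun M => rep_induction (isClosed_le
    ((f.continuous M).sub (ImagPred₂.continuous _ M)).abs continuous_const) fun x y => ?_⟩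
  rw [hD]
  let z : ∀ a, M.str.carrier (Sum.elim E.srt S.srt a) := fun a =>
    Sum.rec (motive := fun a => M.str.carrier (Sum.elim E.srt S.srt a)) x y a
  have h1 := h M z
  have h2 := hf.choose_spec M z
  change |f.val M (E.rep x) (S.rep y) - _| ≤ _ at h1
  change |hf.choose.val M (E.rep x) (S.rep y) - φ.eval M.str fun k => z (ρ k)| ≤
    1 / ((m : ℝ) + 1) at h2
  rw [abs_le] at *
  constructor <;> linarith [h1.1, h1.2, h2.1, h2.2]

end ImagPred₂

/-! ### Ultrapowers of metric structures -/

theorem tendsto_limUnder_of_bounded {I : Type*} (U : Ultrafilter I) {f : I → ℝ} {B : ℝ}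
    (hf : ∀ i, |f i| ≤ B) : Tendsto f U (𝓝 (limUnder (U : Filter I) f)) := by
  refine tendsto_nhds_limUnder ?_
  obtain ⟨x, -, hx⟩ := (isCompact_Icc (a := -B) (b := B)).ultrafilter_le_nhds (U.map f) <| by
    rw [le_principal_iff, Ultrafilter.coe_map, mem_map]
    exact univ_mem' fun i => abs_le.1 (hf i)
  exact ⟨x, hx⟩

section Ultrapower

/-- Families of elements of a sort, before they are identified modulo an ultrafilter. -/
structure PrePower (M : Structure L) {I : Type u} (U : Ultrafilter I) (s : L.Srt) where
  val : I → M.carrier s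

variable (M : Structure L) {I : Type u} (U : Ultrafilter I)

theorem PrePower.tendsto_limUnder_dist {s : L.Srt} (x y : I → M.carrier s) :
    Tendsto (fun i => dist (x i) (y i)) U
      (𝓝 (limUnder (U : Filter I) fun i => dist (x i) (y i))) :=
  tendsto_limUnder_of_bounded U (B := L.diam s) fun i => by
    rw [abs_of_nonneg dist_nonneg]
    exact M.dist_le s _ _

/-- The distance of two families is the limit of the distances along the ultrafilter. -/
instance (s : L.Srt) : PseudoMetricSpace (PrePower M U s) where
  dist x y := limUnder (U : Filter I) fun i => dist (x.val i) (y.val i)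
  dist_self x := by
    simp only [dist_self]
    exact tendsto_const_nhds.limUnder_eq
  dist_comm x y := by simp only [dist_comm]
  dist_triangle x y z := le_of_tendsto_of_tendsto'
    (PrePower.tendsto_limUnder_dist M U x.val z.val)
    ((PrePower.tendsto_limUnder_dist M U x.val y.val).add
      (PrePower.tendsto_limUnder_dist M U y.val z.val)) fun i => dist_triangle _ _ _

theorem PrePower.tendsto_dist {s : L.Srt} (x y : PrePower M U s) :
    Tendsto (fun i => dist (x.val i) (y.val i)) U (𝓝 (dist x y)) :=
  PrePower.tendsto_limUnder_dist M U x.val y.val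

/-- Ultrapowers along countably incomplete ultrafilters are complete: the limit of a fast Cauchy
sequence of families is a diagonal family. -/
theorem PrePower.completeSpace {ω : I → ℕ} (hω : Tendsto ω U atTop) (s : L.Srt) :
    CompleteSpace (PrePower M U s) := by
  classical
  refine Metric.complete_of_convergent_controlled_sequences (fun n : ℕ => 1 / ((n : ℝ) + 1))
    (fun n => by positivity) fun x hx => ?_
  let good (i : I) (n : ℕ) : Prop :=
    ∀ a ≤ n, dist ((x a).val i) ((x n).val i) < 1 / ((a : ℝ) + 1)
  have hgood : ∀ n, ∀ᶠ i in (U : Filter I), good i n := fun n => by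
    have : ∀ᶠ i in (U : Filter I), ∀ a ∈ Set.Iic n,
        dist ((x a).val i) ((x n).val i) < 1 / ((a : ℝ) + 1) :=
      (eventually_all_finite (Set.finite_Iic n)).2 fun a ha =>
        (PrePower.tendsto_dist M U (x a) (x n)).eventually_lt_const (hx a a n le_rfl ha)
    exact this
  -- At `i`, follow the sequence for as long as it is Cauchy there, but at most up to `ω i`.
  let m (i : I) : ℕ := Nat.findGreatest (good i) (ω i)
  refine ⟨⟨fun i => (x (m i)).val i⟩, ?_⟩
  refine tendsto_iff_dist_tendsto_zero.2 (squeeze_zero (fun _ => dist_nonneg) (fun n => ?_)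
    tendsto_one_div_add_atTop_nhds_zero_nat)
  refine le_of_tendsto (PrePower.tendsto_dist M U _ _) ?_
  filter_upwards [hgood n, hω.eventually_ge_atTop n] with i h1 h2
  exact (Nat.findGreatest_spec h2 h1 n (Nat.le_findGreatest h2 h1)).le

/-- The class of a family in the ultrapower. -/
def cls {s : L.Srt} (x : I → M.carrier s) : SeparationQuotient (PrePower M U s) :=
  SeparationQuotient.mk ⟨x⟩

/-- A family that represents an element of the ultrapower. -/
def clsOut {s : L.Srt} (x : SeparationQuotient (PrePower M U s)) : I → M.carrier s :=
  (Function.surjInv SeparationQuotient.surjective_mk x).val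

theorem cls_clsOut {s : L.Srt} (x : SeparationQuotient (PrePower M U s)) :
    cls M U (clsOut M U x) = x :=
  Function.surjInv_eq SeparationQuotient.surjective_mk x

theorem tendsto_dist_cls {s : L.Srt} (x y : I → M.carrier s) :
    Tendsto (fun i => dist (x i) (y i)) U (𝓝 (dist (cls M U x) (cls M U y))) := by
  rw [cls, cls, SeparationQuotient.dist_mk]
  exact PrePower.tendsto_dist M U ⟨x⟩ ⟨y⟩

theorem tendsto_dist_clsOut {s : L.Srt} (x y : SeparationQuotient (PrePower M U s)) :
    Tendsto (fun i => dist (clsOut M U x i) (clsOut M U y i)) U (𝓝 (dist x y)) := by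
  simpa only [cls_clsOut] using tendsto_dist_cls M U (clsOut M U x) (clsOut M U y)

/-- The ultrapower of a metric structure along a countably incomplete ultrafilter; the function `ω`
witnesses the incompleteness. -/
def Structure.ultrapower (ω : I → ℕ) (hω : Tendsto ω U atTop) : Structure L where
  carrier s := SeparationQuotient (PrePower M U s)
  metric s := inferInstance
  complete s := by
    have := PrePower.completeSpace M U hω s
    infer_instance
  nonempty s := ⟨cls M U fun _ => Classical.arbitrary _⟩
  dist_le s x y := le_of_tendsto' (tendsto_dist_clsOut M U x y) fun i => M.dist_le s _ _
  fn f x := cls M U fun i => M.fn f fun k => clsOut M U (x k) i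
  fn_uc f ε hε x y h := by
    refine le_of_tendsto (tendsto_dist_cls M U _ _) ?_
    filter_upwards [eventually_all.2 fun k =>
      (tendsto_dist_clsOut M U (x k) (y k)).eventually_lt_const (h k)] with i hi
    exact M.fn_uc f ε hε _ _ hi
  rel R x := limUnder (U : Filter I) fun i => M.rel R fun k => clsOut M U (x k) i
  rel_le R x := le_of_tendsto'
    (tendsto_limUnder_of_bounded U (B := L.relBound R) fun i => M.rel_le R _).abs
    fun i => M.rel_le R _
  rel_uc R ε hε x y h := by
    refine le_of_tendsto ((tendsto_limUnder_of_bounded U (B := L.relBound R)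
      fun i => M.rel_le R _).sub (tendsto_limUnder_of_bounded U (B := L.relBound R)
      fun i => M.rel_le R _)).abs ?_
    filter_upwards [eventually_all.2 fun k =>
      (tendsto_dist_clsOut M U (x k) (y k)).eventually_lt_const (h k)] with i hi
    exact M.rel_uc R ε hε _ _ hi

variable (ω : I → ℕ) (hω : Tendsto ω U atTop)

theorem tendsto_dist_clsOut_cls {s : L.Srt} (x : I → M.carrier s) :
    Tendsto (fun i => dist (clsOut M U (cls M U x) i) (x i)) U (𝓝 0) := by
  have := tendsto_dist_cls M U (clsOut M U (cls M U x)) x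
  rwa [cls_clsOut, dist_self] at this

theorem ultrapower_fn (f : L.Fn) (x : ∀ k, I → M.carrier (L.fnDom f k)) :
    (M.ultrapower U ω hω).fn f (fun k => cls M U (x k)) =
      cls M U fun i => M.fn f fun k => x k i := by
  change cls M U (fun i => M.fn f fun k => clsOut M U (cls M U (x k)) i) = _
  refine eq_of_forall_dist_le fun ε hε => le_of_tendsto (tendsto_dist_cls M U _ _) ?_
  filter_upwards [eventually_all.2 fun k =>
    (tendsto_dist_clsOut_cls M U (x k)).eventually_lt_const (L.fnMod_pos f ε hε)] with i hi
  exact M.fn_uc f ε hε _ _ hi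

theorem ultrapower_rel (R : L.Rel) (x : ∀ k, I → M.carrier (L.relDom R k)) :
    Tendsto (fun i => M.rel R fun k => x k i) U
      (𝓝 ((M.ultrapower U ω hω).rel R fun k => cls M U (x k))) := by
  have h : Tendsto (fun i => M.rel R fun k => clsOut M U (cls M U (x k)) i) U
      (𝓝 ((M.ultrapower U ω hω).rel R fun k => cls M U (x k))) :=
    tendsto_limUnder_of_bounded U (B := L.relBound R) fun i => M.rel_le R _
  have h' : Tendsto (fun i => (M.rel R fun k => x k i) -
      M.rel R fun k => clsOut M U (cls M U (x k)) i) U (𝓝 0) := by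
    rw [Metric.tendsto_nhds]
    intro ε hε
    filter_upwards [eventually_all.2 fun k => (tendsto_dist_clsOut_cls M U
      (x k)).eventually_lt_const (L.relMod_pos R (ε / 2) (by positivity))] with i hi
    have := M.rel_uc R (ε / 2) (by positivity) _ _ hi
    rw [Real.dist_eq, sub_zero, abs_sub_comm]
    linarith
  simpa using h'.add h

theorem ultrapower_term {n : ℕ} {σ : Fin n → L.Srt} {s : L.Srt} (t : Term L σ s)
    (v : ∀ k, I → M.carrier (σ k)) :
    t.eval (M.ultrapower U ω hω) (fun k => cls M U (v k)) =
      cls M U fun i => t.eval M fun k => v k i := by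
  induction t with
  | var k => rfl
  | app f ts ih =>
    simp only [Term.eval, ih]
    exact ultrapower_fn M U ω hω f _

theorem extend_cls {n : ℕ} {σ : Fin n → L.Srt} {s : L.Srt} (a : I → M.carrier s)
    (v : ∀ k, I → M.carrier (σ k)) :
    extend (M.ultrapower U ω hω) (cls M U a) (fun k => cls M U (v k)) =
      fun k => cls M U fun i => extend M (a i) (fun k => v k i) k := by
  funext k
  refine Fin.cases ?_ (fun j => ?_) k <;> rfl

/-- Łoś's theorem: the value of a formula in the ultrapower is the limit of its values. -/
theorem ultrapower_formula {n : ℕ} {σ : Fin n → L.Srt} (φ : Formula L n σ) :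
    ∀ v : (∀ k, I → M.carrier (σ k)), Tendsto (fun i => φ.eval M fun k => v k i) U
      (𝓝 (φ.eval (M.ultrapower U ω hω) fun k => cls M U (v k))) := by
  induction φ with
  | dist t t' =>
    intro v
    simp only [Formula.eval, ultrapower_term]
    exact tendsto_dist_cls M U _ _
  | rel R ts =>
    intro v
    simp only [Formula.eval, ultrapower_term]
    exact ultrapower_rel M U ω hω R _
  | conn m c φ ih =>
    intro v
    simp only [Formula.eval]
    exact (c.continuous.tendsto _).comp (tendsto_pi_nhds.2 fun k => ih k v)
  | @sup n σ s φ ih =>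
    intro v
    obtain ⟨B, hB⟩ := φ.exists_bound
    have bdd : ∀ (M : Structure L) w,
        BddAbove (Set.range fun a => φ.eval M (extend M a w)) := fun M w =>
      ⟨B, by rintro _ ⟨a, rfl⟩; exact (abs_le.1 (hB M _)).2⟩
    have lim : ∀ a : I → M.carrier s, Tendsto
        (fun i => φ.eval M (extend M (a i) fun k => v k i)) U
        (𝓝 (φ.eval (M.ultrapower U ω hω) (extend _ (cls M U a) fun k => cls M U (v k)))) :=
      fun a => by
        rw [extend_cls]
        exact ih fun k i => extend M (a i) (fun k => v k i) k
    simp only [Formula.eval]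
    have h := tendsto_limUnder_of_bounded U (f := fun i =>
      ⨆ a, φ.eval M (extend M a fun k => v k i)) (B := B) fun i => abs_iSup_le fun a => hB _ _
    convert h using 2
    apply le_antisymm
    · refine ciSup_le fun A => ?_
      rw [← cls_clsOut M U A]
      exact le_of_tendsto_of_tendsto' (lim _) h fun i => le_ciSup (bdd M _) _
    · refine le_of_forall_pos_sub_le fun ε hε => ?_
      have hex : ∀ i, ∃ a, (⨆ a, φ.eval M (extend M a fun k => v k i)) - ε <
          φ.eval M (extend M a fun k => v k i) := fun i =>
        exists_lt_of_lt_ciSup (by linarith)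
      choose a ha using hex
      exact (le_of_tendsto_of_tendsto' (h.sub_const ε) (lim a) fun i => (ha i).le).trans
        (le_ciSup (f := fun a => φ.eval (M.ultrapower U ω hω) (extend (M.ultrapower U ω hω) a
          fun k => cls M U (v k))) (bdd _ _) (cls M U a))
  | @inf n σ s φ ih =>
    intro v
    obtain ⟨B, hB⟩ := φ.exists_bound
    have bdd : ∀ (M : Structure L) w,
        BddBelow (Set.range fun a => φ.eval M (extend M a w)) := fun M w =>
      ⟨-B, by rintro _ ⟨a, rfl⟩; exact (abs_le.1 (hB M _)).1⟩
    have lim : ∀ a : I → M.carrier s, Tendsto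
        (fun i => φ.eval M (extend M (a i) fun k => v k i)) U
        (𝓝 (φ.eval (M.ultrapower U ω hω) (extend _ (cls M U a) fun k => cls M U (v k)))) :=
      fun a => by
        rw [extend_cls]
        exact ih fun k i => extend M (a i) (fun k => v k i) k
    simp only [Formula.eval]
    have h := tendsto_limUnder_of_bounded U (f := fun i =>
      ⨅ a, φ.eval M (extend M a fun k => v k i)) (B := B) fun i => abs_iInf_le fun a => hB _ _
    convert h using 2
    apply le_antisymm
    · refine le_of_forall_pos_le_add fun ε hε => ?_
      have hex : ∀ i, ∃ a, φ.eval M (extend M a fun k => v k i) <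
          (⨅ a, φ.eval M (extend M a fun k => v k i)) + ε := fun i =>
        exists_lt_of_ciInf_lt (by linarith)
      choose a ha using hex
      exact (ciInf_le (bdd _ _) (cls M U a)).trans
        (le_of_tendsto_of_tendsto' (lim a) (h.add_const ε) fun i => (ha i).le)
    · refine le_ciInf fun A => ?_
      rw [← cls_clsOut M U A]
      exact le_of_tendsto_of_tendsto' h (lim _) fun i => ciInf_le (bdd M _) _

end Ultrapower

namespace Model

variable (N : Model T) {I : Type u} (U : Ultrafilter I) (ω : I → ℕ) (hω : Tendsto ω U atTop)

/-- The ultrapower of a model. -/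
def ultrapower : Model T where
  str := N.str.ultrapower U ω hω
  sat φ hφ := by
    refine tendsto_nhds_unique (f := fun _ : I => (0 : ℝ)) (l := (U : Filter I)) ?_
      tendsto_const_nhds
    have h := ultrapower_formula N.str U ω hω φ fun k => k.elim0
    have h1 : φ.eval (N.str.ultrapower U ω hω) (fun k : Fin 0 => cls N.str U k.elim0) =
        φ.eval (N.str.ultrapower U ω hω) fun k => k.elim0 :=
      congrArg _ (funext fun k => k.elim0)
    rw [← h1]
    exact h.congr fun i => (congrArg _ (funext fun k => k.elim0)).trans (N.sat φ hφ)

/-- The diagonal embedding into an ultrapower. -/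
def diag : ElemEmb N.str (N.ultrapower U ω hω).str where
  toFun _ a := cls N.str U fun _ => a
  map_formula φ v := tendsto_nhds_unique (l := (U : Filter I))
    (ultrapower_formula N.str U ω hω φ fun k _ => v k) tendsto_const_nhds

variable {N U ω hω}

theorem tendsto_definable {α : Type} {σ : α → L.Srt}
    {F : ∀ M : Model T, (∀ a, M.str.carrier (σ a)) → ℝ} (hF : IsDefinable T σ F)
    (v : ∀ a, I → N.str.carrier (σ a)) :
    Tendsto (fun i => F N fun a => v a i) U
      (𝓝 (F (N.ultrapower U ω hω) fun a => cls N.str U (v a))) := by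
  rw [Metric.tendsto_nhds]
  intro ε hε
  obtain ⟨n, ρ, φ, h⟩ := hF (ε / 3) (by positivity)
  have h1 := ultrapower_formula N.str U ω hω φ fun k => v (ρ k)
  rw [Metric.tendsto_nhds] at h1
  have h2 := h (N.ultrapower U ω hω) fun a => cls N.str U (v a)
  change |_ - φ.eval (N.str.ultrapower U ω hω) _| ≤ _ at h2
  filter_upwards [h1 (ε / 3) (by positivity)] with i hi
  have h3 := h N fun a => v a i
  rw [Real.dist_eq] at hi ⊢
  rw [abs_lt] at *
  rw [abs_le] at h2 h3
  constructor <;> linarith [h2.1, h2.2, h3.1, h3.2, hi.1, hi.2]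

variable (ω hω) in
/-- The element `Z` of an imaginary sort of the ultrapower is the class of the family `z`.  Elements
of imaginary sorts are only limits of tuples, so this is expressed by approximation: uniformly close
to `z` there is a family of tuples whose class is close to `Z`. -/
def IsUlim (E : ImagSort T) (z : I → E.Elt N) (Z : E.Elt (N.ultrapower U ω hω)) : Prop :=
  ∀ ε : ℝ, 0 < ε → ∃ r : I → ∀ a, N.str.carrier (E.srt a),
    (∀ i, dist (z i) (E.rep (r i)) < ε) ∧
      dist Z (E.rep (M := N.ultrapower U ω hω) fun a => cls N.str U fun i => r i a) < ε

theorem tendsto_dist_rep (E : ImagSort T) (r r' : I → ∀ a, N.str.carrier (E.srt a)) :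
    Tendsto (fun i => dist (E.rep (r i)) (E.rep (r' i))) U
      (𝓝 (dist (E.rep (M := N.ultrapower U ω hω) fun a => cls N.str U fun i => r i a)
        (E.rep (M := N.ultrapower U ω hω) fun a => cls N.str U fun i => r' i a))) :=
  tendsto_definable (ImagPred₂.dist (E := E)).definable fun c i =>
    Sum.rec (motive := fun c => N.str.carrier (Sum.elim E.srt E.srt c)) (r i) (r' i) c

variable (U ω hω) in
theorem exists_isUlim (E : ImagSort T) (z : I → E.Elt N) : ∃ Z, IsUlim (U := U) ω hω E z Z := by
  choose r hr using fun (m : ℕ) (i : I) =>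
    E.exists_dist_rep_lt (z i) (ε := 1 / ((m : ℝ) + 1)) (by positivity)
  let R (m : ℕ) : E.Elt (N.ultrapower U ω hω) := E.rep fun a => cls N.str U fun i => r m i a
  have hR : CauchySeq R := by
    refine cauchySeq_of_le_tendsto_0 (fun m : ℕ => 1 / ((m : ℝ) + 1) + 1 / ((m : ℝ) + 1))
      (fun n m k hn hm => ?_)
      (by
        simpa using (tendsto_one_div_add_atTop_nhds_zero_nat (𝕜 := ℝ)).add
          (tendsto_one_div_add_atTop_nhds_zero_nat (𝕜 := ℝ)))
    refine le_of_tendsto' (tendsto_dist_rep E (r n) (r m)) fun i => ?_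
    refine (dist_triangle_left _ _ (z i)).trans (add_le_add ?_ ?_)
    · exact (hr n i).le.trans (Nat.one_div_le_one_div hn)
    · exact (hr m i).le.trans (Nat.one_div_le_one_div hm)
  obtain ⟨Z, hZ⟩ := cauchySeq_tendsto_of_complete hR
  refine ⟨Z, fun ε hε => ?_⟩
  obtain ⟨m, hm, hm'⟩ := ((tendsto_one_div_add_atTop_nhds_zero_nat.eventually_lt_const hε).and
    ((tendsto_iff_dist_tendsto_zero.1 hZ).eventually_lt_const hε)).exists
  exact ⟨r m, fun i => (hr m i).trans hm, by rwa [dist_comm]⟩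

theorem isUlim_const (E : ImagSort T) (z : E.Elt N) :
    IsUlim (U := U) ω hω E (fun _ => z) (E.map (N.diag U ω hω) z) := fun ε hε => by
  obtain ⟨x, hx⟩ := E.exists_dist_rep_lt z hε
  refine ⟨fun _ => x, fun _ => hx, ?_⟩
  have h := (E.isometry_map (N.diag U ω hω)).dist_eq z (E.rep x)
  rw [E.map_rep] at h
  exact h.trans_lt hx

/-- Łoś's theorem for definable predicates on imaginary sorts. -/
theorem IsUlim.tendsto {E S : ImagSort T} (f : ImagPred₂ E S) {z : I → E.Elt N}
    {Z : E.Elt (N.ultrapower U ω hω)} (hz : IsUlim ω hω E z Z) {w : I → S.Elt N}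
    {W : S.Elt (N.ultrapower U ω hω)} (hw : IsUlim ω hω S w W) :
    Tendsto (fun i => f.val N (z i) (w i)) U (𝓝 (f.val _ Z W)) := by
  rw [Metric.tendsto_nhds]
  intro ε hε
  obtain ⟨δ, hδ, h⟩ := f.uc (ε / 4) (by positivity)
  obtain ⟨r, hr, hr'⟩ := hz δ hδ
  obtain ⟨q, hq, hq'⟩ := hw δ hδ
  have h1 : Tendsto (fun i => f.val N (E.rep (r i)) (S.rep (q i))) U
      (𝓝 (f.val _ (E.rep (M := N.ultrapower U ω hω) fun a => cls N.str U fun i => r i a)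
        (S.rep (M := N.ultrapower U ω hω) fun a => cls N.str U fun i => q i a))) :=
    tendsto_definable f.definable fun c i =>
      Sum.rec (motive := fun c => N.str.carrier (Sum.elim E.srt S.srt c)) (r i) (q i) c
  rw [Metric.tendsto_nhds] at h1
  have h2 := h _ _ _ _ _ hr' hq'
  filter_upwards [h1 (ε / 4) (by positivity)] with i hi
  have h3 := h _ _ _ _ _ (hr i) (hq i)
  rw [Real.dist_eq] at hi ⊢
  rw [abs_lt] at *
  rw [abs_le] at h2 h3
  constructor <;> linarith [h2.1, h2.2, h3.1, h3.2, hi.1, hi.2]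

end Model

/-- An ultrafilter that contains every cone of the directed set of pairs of a finite set of
conditions and a precision. -/
theorem exists_ultrafilter_le_atTop (J : Type u) :
    ∃ U : Ultrafilter (Finset J × ℕ), (U : Filter (Finset J × ℕ)) ≤ atTop ∧
      Tendsto Prod.snd (U : Filter (Finset J × ℕ)) atTop := by
  classical
  have h : ((Ultrafilter.of atTop : Ultrafilter (Finset J × ℕ)) : Filter (Finset J × ℕ)) ≤
      atTop := Ultrafilter.of_le _
  refine ⟨Ultrafilter.of atTop, h, Tendsto.mono_left ?_ h⟩
  rw [← prod_atTop_atTop_eq]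
  exact tendsto_snd

/-! ### Bounded closure and asymptotic freeness -/

theorem not_isCompact_of_separated {X : Type*} [MetricSpace X] {s : Set X} {x : ℕ → X} {δ : ℝ}
    (hδ : 0 < δ) (hx : ∀ n, x n ∈ s) (h : ∀ n m, n ≠ m → δ ≤ dist (x n) (x m)) :
    ¬ IsCompact s := fun hs => by
  obtain ⟨z, -, φ, hφ, hz⟩ := hs.tendsto_subseq hx
  obtain ⟨N, hN⟩ := Metric.cauchySeq_iff'.1 hz.cauchySeq δ hδ
  exact (hN (N + 1) (Nat.le_succ N)).not_ge (h _ _ (hφ (Nat.lt_succ_self N)).ne')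

namespace ImagPred₂

variable {E S S' : ImagSort T}

/-- The infimum in `infAdd`, taken over representatives, bounds the values at all elements of the
completion. -/
theorem infAdd_le {f : ImagPred₂ E S} {g : ImagPred₂ S' S} {M : Model T} (b : E.Elt M)
    (x : S'.Elt M) (y : S.Elt M) : (f.infAdd g).val M b x ≤ f.val M b y + g.val M x y := by
  have hc : Continuous fun y => f.val M b y + g.val M x y :=
    ((f.continuous M).comp (continuous_const.prodMk continuous_id)).add
      ((g.continuous M).comp (continuous_const.prodMk continuous_id))
  refine (S.denseRange_rep M).induction_on (p := fun y => _ ≤ f.val M b y + g.val M x y) y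
    (isClosed_le continuous_const hc) fun z => ciInf_le ?_ z
  obtain ⟨B, hB⟩ := f.exists_bound
  obtain ⟨B', hB'⟩ := g.exists_bound
  refine ⟨-B + -B', ?_⟩
  rintro _ ⟨z, rfl⟩
  exact add_le_add (abs_le.1 (hB _ _ _)).1 (abs_le.1 (hB' _ _ _)).1

theorem separation_le {θ : ImagPred₂ E S} (hθ : ∀ M x y, 0 ≤ θ.val M x y) {k : ℕ} {δ : ℝ}
    {M : Model T} (y : S.Elt M) (β : Fin k → E.Elt M)
    (hβ : ∀ i j, i ≠ j → δ ≤ Dist.dist (β i) (β j)) :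
    (θ.separation k δ).val M y ≤ ∑ i, θ.val M (β i) y := by
  have key : ∀ β : Fin k → E.Elt M, (θ.separation k δ).val M y ≤ (∑ i, θ.val M (β i) y) +
      ∑ q : {q : Fin k × Fin k // q.1 ≠ q.2}, max (δ - Dist.dist (β q.1.1) (β q.1.2)) 0 := by
    intro β
    have hd : DenseRange (Pi.map fun (_ : Fin k) => E.rep (M := M)) :=
      DenseRange.piMap fun _ => E.denseRange_rep M
    refine hd.induction_on (p := fun β : Fin k → E.Elt M => (θ.separation k δ).val M y ≤
      (∑ i, θ.val M (β i) y) +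
      ∑ q : {q : Fin k × Fin k // q.1 ≠ q.2}, max (δ - Dist.dist (β q.1.1) (β q.1.2)) 0) β
      (isClosed_le continuous_const (Continuous.add ?_ ?_)) fun t => ?_
    · exact continuous_finsetSum _ fun i _ =>
        (θ.continuous M).comp (f := fun b : Fin k → E.Elt M => (b i, y))
          ((continuous_apply i).prodMk continuous_const)
    · exact continuous_finsetSum _ fun q _ => (continuous_const.sub
        ((continuous_apply _).dist (continuous_apply _))).max continuous_const
    · refine ciInf_le (f := fun t : (∀ c : Fin k × E.ι, M.str.carrier (E.srt c.2)) =>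
        ((∑ i, θ.val M (E.rep fun a => t (i, a)) y) +
        ∑ q : {q : Fin k × Fin k // q.1 ≠ q.2},
        max (δ - Dist.dist (E.rep fun a => t (q.1.1, a)) (E.rep fun a => t (q.1.2, a))) 0))
        ⟨0, ?_⟩ fun c => t c.1 c.2
      rintro _ ⟨t, rfl⟩
      exact add_nonneg (Finset.sum_nonneg fun i _ => hθ _ _ _)
        (Finset.sum_nonneg fun q _ => le_max_right _ _)
  have h0 : ∑ q : {q : Fin k × Fin k // q.1 ≠ q.2},
      max (δ - Dist.dist (β q.1.1) (β q.1.2)) 0 = 0 :=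
    Finset.sum_eq_zero fun q _ => max_eq_right (sub_nonpos.2 (hβ _ _ q.2))
  exact (key β).trans_eq (by rw [h0, add_zero])

theorem exists_of_separation_lt {θ : ImagPred₂ E S} (hθ : ∀ M x y, 0 ≤ θ.val M x y) {k : ℕ}
    {δ η : ℝ} {M : Model T} {y : S.Elt M} (h : (θ.separation k δ).val M y < η) :
    ∃ β : Fin k → E.Elt M, (∀ i, θ.val M (β i) y < η) ∧
      ∀ i j, i ≠ j → δ - η < Dist.dist (β i) (β j) := by
  obtain ⟨t, ht⟩ := exists_lt_of_ciInf_lt h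
  refine ⟨fun i => E.rep fun a => t (i, a), fun i => ?_, fun i j hij => ?_⟩
  · refine lt_of_le_of_lt ?_ ht
    refine le_add_of_le_of_nonneg ?_ (Finset.sum_nonneg fun q _ => le_max_right _ _)
    exact Finset.single_le_sum (f := fun i => θ.val M (E.rep fun a => t (i, a)) y)
      (fun i _ => hθ _ _ _) (Finset.mem_univ i)
  · have h1 : δ - Dist.dist (E.rep fun a => t (i, a)) (E.rep fun a => t (j, a)) < η := by
      refine lt_of_le_of_lt ((le_max_left _ 0).trans ?_) ht
      refine le_add_of_nonneg_of_le (Finset.sum_nonneg fun q _ => hθ _ _ _) ?_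
      exact Finset.single_le_sum (f := fun q : {q : Fin k × Fin k // q.1 ≠ q.2} =>
        max (δ - Dist.dist (E.rep fun a => t (q.1.1, a)) (E.rep fun a => t (q.1.2, a))) 0)
        (fun q _ => le_max_right _ _) (Finset.mem_univ ⟨(i, j), hij⟩)
    linarith

/-- Equality of types may be tested on a uniformly dense family of predicates. -/
theorem eq_of_dense {J : Type*} {D : J → ImagPred₂ E S}
    (hD : ∀ (f : ImagPred₂ E S) (ε : ℝ), 0 < ε →
      ∃ j, ∀ M x y, |f.val M x y - (D j).val M x y| ≤ ε)
    {M N : Model T} {x : E.Elt M} {y : S.Elt M} {x' : E.Elt N} {y' : S.Elt N}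
    (h : ∀ j, (D j).val N x' y' = (D j).val M x y) (f : ImagPred₂ E S) :
    f.val N x' y' = f.val M x y := by
  refine eq_of_forall_dist_le fun ε hε => ?_
  obtain ⟨j, hj⟩ := hD f (ε / 2) (by positivity)
  have h1 := hj M x y
  have h2 := hj N x' y'
  rw [h] at h2
  rw [Real.dist_eq]
  rw [abs_le] at *
  constructor <;> linarith [h1.1, h1.2, h2.1, h2.2]

end ImagPred₂

/-- If `b` is in the bounded closure of `y`, then for every `δ > 0` there is a definable predicate
`θ` vanishing at `(b, y)` and a number `k` such that no `k` pairwise `δ`-separated elements come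
close to satisfying `θ(·, y) = 0`: otherwise the type of `b` over `y` has infinitely many
separated realisations in an ultrapower. -/
theorem exists_separation_pos {E S : ImagSort T} {M : Model T} {b : E.Elt M} {y : S.Elt M}
    (hb : (⟨E, b⟩ : Σ E : ImagSort T, E.Elt M) ∈ bdd y) {δ : ℝ} (hδ : 0 < δ) :
    ∃ (θ : ImagPred₂ E S) (k : ℕ), (∀ M x y, 0 ≤ θ.val M x y) ∧ θ.val M b y = 0 ∧
      0 < (θ.separation k δ).val M y := by
  classical
  by_contra! H
  obtain ⟨J, D, hD⟩ := ImagPred₂.exists_dense_family E S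
  obtain ⟨U, hU, hω⟩ := exists_ultrafilter_le_atTop J
  choose θ h0 h1 h2 using fun F : Finset J =>
    ImagPred₂.exists_conj F D fun j => (D j).val M b y
  have hpos : ∀ k : ℕ, (0 : ℝ) < min (1 / ((k : ℝ) + 1)) (δ / 2) := fun k => by positivity
  -- The slack `δ / 2` leaves the approximate elements `δ / 2`-separated.
  choose β hβ hβ' using fun i : Finset J × ℕ => ImagPred₂.exists_of_separation_lt (h0 i.1)
    ((H (θ i.1) i.2 (h0 i.1) (h2 i.1 M b y fun _ _ => rfl)).trans_lt (hpos i.2))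
  -- For `n ≥ i.2` the value is irrelevant, as `i.2` tends to infinity along `U`.
  let γ (n : ℕ) (i : Finset J × ℕ) : E.Elt M := if h : n < i.2 then β i ⟨n, h⟩ else b
  choose Γ hΓ using fun n => Model.exists_isUlim U Prod.snd hω E (γ n)
  refine not_isCompact_of_separated (x := Γ) (half_pos hδ) (fun n => ?_) (fun n m hnm => ?_)
    (hb _ (M.diag U Prod.snd hω))
  · refine ImagPred₂.eq_of_dense hD fun j => ?_
    refine tendsto_nhds_unique ((hΓ n).tendsto (D j) (Model.isUlim_const S y)) ?_
    rw [tendsto_iff_dist_tendsto_zero]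
    refine squeeze_zero' (Eventually.of_forall fun _ => dist_nonneg) ?_
      (tendsto_one_div_add_atTop_nhds_zero_nat.comp hω)
    filter_upwards [hω.eventually_gt_atTop n,
      (tendsto_fst.mono_left (hU.trans_eq prod_atTop_atTop_eq.symm)).eventually_ge_atTop {j}]
      with i hi hj
    have e : γ n i = β i ⟨n, hi⟩ := dif_pos hi
    rw [e, Real.dist_eq]
    exact (h1 i.1 j (hj (Finset.mem_singleton_self j)) M _ _).trans
      ((hβ i _).le.trans (min_le_left _ _))
  · refine ge_of_tendsto ((hΓ n).tendsto ImagPred₂.dist (hΓ m)) ?_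
    filter_upwards [hω.eventually_gt_atTop n, hω.eventually_gt_atTop m] with i hn hm
    have e : γ n i = β i ⟨n, hn⟩ := dif_pos hn
    have e' : γ m i = β i ⟨m, hm⟩ := dif_pos hm
    rw [e, e']
    have h3 := hβ' i ⟨n, hn⟩ ⟨m, hm⟩ (by simpa using hnm)
    have h4 := min_le_right (1 / ((i.2 : ℝ) + 1)) (δ / 2)
    change δ / 2 ≤ dist _ _
    linarith

/-- Realisations `β n` of the type of `b` over `x` can be completed, in an elementary extension, to
pairs `(β n, Y n)` that behave over `x` like `(b, y)`. -/
theorem exists_extension_conjugates {E S S' : ImagSort T} {M N : Model T}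
    (j : ElemEmb M.str N.str) {b : E.Elt M} {x : S'.Elt M} (y : S.Elt M) {β : ℕ → E.Elt N}
    (hβ : ∀ n, β n ∈ conjugates j b x) :
    ∃ (N' : Model T) (j' : ElemEmb N.str N'.str) (Y : ℕ → S.Elt N'), ∀ n,
      (∀ f : ImagPred₂ E S, f.val N' (E.map j' (β n)) (Y n) = f.val M b y) ∧
      ∀ g : ImagPred₂ S' S, g.val N' (S'.map j' (S'.map j x)) (Y n) = g.val M x y := by
  classical
  obtain ⟨J, D, hD⟩ := ImagPred₂.exists_dense_family E S
  obtain ⟨J', D', hD'⟩ := ImagPred₂.exists_dense_family S' S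
  obtain ⟨U, hU, hω⟩ := exists_ultrafilter_le_atTop (J ⊕ J')
  choose θ h0 h1 h2 using fun F : Finset (J ⊕ J') =>
    ImagPred₂.exists_conj F.toLeft D fun j => (D j).val M b y
  choose θ' h0' h1' h2' using fun F : Finset (J ⊕ J') =>
    ImagPred₂.exists_conj F.toRight D' fun j => (D' j).val M x y
  have hlt : ∀ (n : ℕ) (i : Finset (J ⊕ J') × ℕ),
      ((θ i.1).infAdd (θ' i.1)).val N (β n) (S'.map j x) < 1 / ((i.2 : ℝ) + 1) := fun n i => by
    -- The infimum is a predicate of `(b, x)`, so it may be computed in `M`, where `y` is a witness.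
    rw [hβ n ((θ i.1).infAdd (θ' i.1))]
    refine (ImagPred₂.infAdd_le b x y).trans_lt ?_
    rw [h2 _ _ _ _ fun _ _ => rfl, h2' _ _ _ _ fun _ _ => rfl, add_zero]
    positivity
  choose t ht using fun n i => exists_lt_of_ciInf_lt (hlt n i)
  choose Y hY using fun n => Model.exists_isUlim U Prod.snd hω S fun i => S.rep (t n i)
  refine ⟨N.ultrapower U Prod.snd hω, N.diag U Prod.snd hω, Y, fun n => ⟨?_, ?_⟩⟩
  · refine ImagPred₂.eq_of_dense hD fun j => ?_
    refine tendsto_nhds_unique ((Model.isUlim_const E (β n)).tendsto (D j) (hY n)) ?_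
    rw [tendsto_iff_dist_tendsto_zero]
    refine squeeze_zero' (Eventually.of_forall fun _ => dist_nonneg) ?_
      (tendsto_one_div_add_atTop_nhds_zero_nat.comp hω)
    filter_upwards [(tendsto_fst.mono_left
      (hU.trans_eq prod_atTop_atTop_eq.symm)).eventually_ge_atTop {Sum.inl j}] with i hj
    rw [Real.dist_eq]
    refine (h1 i.1 j (by simpa using hj) N _ _).trans (le_trans ?_ (ht n i).le)
    exact le_add_of_nonneg_right (h0' _ _ _ _)
  · refine ImagPred₂.eq_of_dense hD' fun j => ?_
    refine tendsto_nhds_unique ((Model.isUlim_const S' _).tendsto (D' j) (hY n)) ?_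
    rw [tendsto_iff_dist_tendsto_zero]
    refine squeeze_zero' (Eventually.of_forall fun _ => dist_nonneg) ?_
      (tendsto_one_div_add_atTop_nhds_zero_nat.comp hω)
    filter_upwards [(tendsto_fst.mono_left
      (hU.trans_eq prod_atTop_atTop_eq.symm)).eventually_ge_atTop {Sum.inr j}] with i hj
    rw [Real.dist_eq]
    refine (h1' i.1 j (by simpa using hj) N _ _).trans (le_trans ?_ (ht n i).le)
    exact le_add_of_nonneg_left (h0 _ _ _ _)

theorem isClosed_conjugates {E S : ImagSort T} {M N : Model T} (j : ElemEmb M.str N.str)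
    (b : E.Elt M) (x : S.Elt M) : IsClosed (conjugates j b x) := by
  have : conjugates j b x = ⋂ f : ImagPred₂ E S,
      {b' | f.val N b' (S.map j x) = f.val M b x} := by
    ext; simp [conjugates]
  rw [this]
  exact isClosed_iInter fun f => isClosed_eq
    ((f.continuous N).comp (continuous_id.prodMk continuous_const)) continuous_const

/-- If the realisations `y'` of `p` at which a definable predicate `f(x, ·)` is bounded away from
`0` form compact sets in all models, and `f(x, y) ≠ 0`, then everything in the bounded closure of
`y` is in the bounded closure of `x`.  The point is transitivity of bounded closure: infinitely
many separated conjugates of `b` over `x` would come with conjugates of `y` over `x`, which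
accumulate at some `y'`, and `b` could not be in the bounded closure of `y`, since `y'` has the
same type as `y`. -/
theorem bdd_subset_bdd {S : ImagSort T} {p : CompleteType S} {f : ImagPred₂ S S}
    (hf : ∀ (N : Model T), ∀ x ∈ p.realisations N, ∀ ε : ℝ, 0 < ε →
      IsCompact {y ∈ p.realisations N | ε ≤ |f.val N x y|})
    {M : Model T} {x y : S.Elt M} (hx : x ∈ p.realisations M) (hy : y ∈ p.realisations M)
    (hxy : f.val M x y ≠ 0) : bdd y ⊆ bdd x := by
  rintro ⟨E, b⟩ hb N j
  refine isCompact_iff_totallyBounded_isComplete.2 ⟨?_, (isClosed_conjugates j b x).isComplete⟩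
  rw [Metric.totallyBounded_iff]
  by_contra! H
  obtain ⟨δ, hδ, H⟩ := H
  obtain ⟨β, hβ, hsep⟩ : ∃ β : ℕ → E.Elt N, (∀ n, β n ∈ conjugates j b x) ∧
      Pairwise (Function.onFun (fun z w => δ ≤ dist z w) β) := by
    have : Std.Symm fun z w : E.Elt N => δ ≤ dist z w := ⟨fun z w h => by rwa [dist_comm]⟩
    refine exists_seq_of_forall_finset_exists' (fun z => z ∈ conjugates j b x)
      (fun z w => δ ≤ dist z w) fun s _ => ?_
    obtain ⟨z, hz, hz'⟩ := Set.not_subset.1 (H s s.finite_toSet)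
    refine ⟨z, hz, fun w hw => ?_⟩
    by_contra! h
    exact hz' (Set.mem_biUnion hw (by rwa [Metric.mem_ball, dist_comm]))
  obtain ⟨θ, k, h0, hθ, hpos⟩ := exists_separation_pos hb hδ
  obtain ⟨N', j', Y, hY⟩ := exists_extension_conjugates j y hβ
  have hYp : ∀ n, Y n ∈ p.realisations N' := fun n g =>
    ((hY n).1 (ImagPred₂.ofRight g)).trans (hy g)
  have hxp : S.map j' (S.map j x) ∈ p.realisations N' := fun g => by
    rw [g.map, g.map, hx g]
  obtain ⟨y', hy', φ, hφ, hlim⟩ := (hf N' _ hxp _ (abs_pos.2 hxy)).tendsto_subseq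
    fun n => ⟨hYp n, by rw [(hY n).2 f]⟩
  set η := (θ.separation k δ).val M y with hη
  have hη' : (θ.separation k δ).val N' y' = η := by rw [hy'.1, hη, hy]
  obtain ⟨ε, hε, huc⟩ := θ.uc (η / (k + 1)) (by positivity)
  obtain ⟨n₀, hn₀⟩ := Metric.tendsto_atTop.1 hlim ε hε
  have h1 := ImagPred₂.separation_le h0 (δ := δ) y'
    (fun i : Fin k => E.map j' (β (φ (n₀ + i)))) fun i i' hii' => by
      rw [(E.isometry_map j').dist_eq]
      exact hsep (hφ.injective.ne (by simpa [Fin.ext_iff] using hii'))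
  have h2 : ∀ i : Fin k, θ.val N' (E.map j' (β (φ (n₀ + i)))) y' ≤ η / (k + 1) := fun i => by
    have h3 := huc N' _ (E.map j' (β (φ (n₀ + i)))) _ _ ((dist_self _).trans_lt hε)
      (hn₀ (n₀ + i) (Nat.le_add_right _ _))
    have h4 : θ.val N' (E.map j' (β (φ (n₀ + i)))) (Y (φ (n₀ + i))) = 0 :=
      ((hY _).1 θ).trans hθ
    change |θ.val N' _ (Y (φ (n₀ + i))) - _| ≤ _ at h3
    rw [h4, zero_sub, abs_neg] at h3
    exact (le_abs_self _).trans h3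
  have h5 := h1.trans (Finset.sum_le_sum fun i _ => h2 i)
  rw [hη', Finset.sum_const, Finset.card_univ, Fintype.card_fin, nsmul_eq_mul, mul_div_assoc',
    le_div_iff₀ (by positivity)] at h5
  nlinarith

/-! ### The action of automorphisms on imaginary sorts -/

/-- The composition of elementary embeddings. -/
def ElemEmb.comp {M N N' : Structure L} (j : ElemEmb N N') (i : ElemEmb M N) : ElemEmb M N' where
  toFun s x := j.toFun s (i.toFun s x)
  map_formula φ v := (j.map_formula φ fun k => i.toFun _ (v k)).trans (i.map_formula φ v)

theorem ImagSort.map_map (E : ImagSort T) {M N N' : Model T} (j : ElemEmb N.str N'.str)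
    (i : ElemEmb M.str N.str) (x : E.Elt M) : E.map j (E.map i x) = E.map (j.comp i) x := by
  have h := UniformSpace.Completion.map_comp (E.isometry_preMap j).uniformContinuous
    (E.isometry_preMap i).uniformContinuous
  exact congrFun h x

theorem smul_mem_bdd {E S : ImagSort T} {M : Model T} (g : Aut M.str) {b : E.Elt M} {x : S.Elt M}
    (h : (⟨E, b⟩ : Σ E : ImagSort T, E.Elt M) ∈ bdd x) :
    (⟨E, g • b⟩ : Σ E : ImagSort T, E.Elt M) ∈ bdd (g • x) := fun N j => by
  have e : conjugates j (g • b) (g • x) = conjugates (j.comp g.toElemEmb) b x := by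
    ext c
    simp only [conjugates, Set.mem_ofPred_eq, ImagSort.smul_def, S.map_map, ImagPred₂.map]
  change IsCompact (conjugates j (g • b) (g • x))
  rw [e]
  exact h N _

theorem bdd_smul_eq_iff {S : ImagSort T} {M : Model T} (g : Aut M.str) {x y : S.Elt M} :
    bdd (g • x) = bdd (g • y) ↔ bdd x = bdd y := by
  have key : ∀ (g : Aut M.str) {x y : S.Elt M}, bdd x = bdd y → bdd (g • x) ⊆ bdd (g • y) := by
    rintro g x y h ⟨E, b⟩ hb
    have h1 := smul_mem_bdd g⁻¹ hb
    rw [inv_smul_smul, h] at h1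
    have h2 := smul_mem_bdd g h1
    rwa [smul_inv_smul] at h2
  refine ⟨fun h => ?_, fun h => (key g h).antisymm (key g h.symm)⟩
  have := (key g⁻¹ h).antisymm (key g⁻¹ h.symm)
  rwa [inv_smul_smul, inv_smul_smul] at this

theorem Aut.continuous_apply {M : Structure L} {s : L.Srt} (x : M.carrier s) :
    Continuous fun g : Aut M => g.toEquiv s x := by
  have h : Continuous fun (g : Aut M) (y : Σ s, M.carrier s) => g.toEquiv y.1 y.2 :=
    continuous_induced_dom
  exact continuous_pi_iff.1 h ⟨s, x⟩

theorem ImagSort.continuous_smul (E : ImagSort T) {M : Model T} (x : E.Elt M) :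
    Continuous fun g : Aut M.str => g • x := by
  have hrep : ∀ t : (∀ k, M.str.carrier (E.srt k)), Continuous fun g : Aut M.str => g • E.rep t := by
    intro t
    rw [continuous_iff_continuousAt]
    intro g₀
    rw [ContinuousAt, Metric.tendsto_nhds]
    intro ε hε
    obtain ⟨n, ρ, φ, h⟩ := (ImagPred₂.dist (E := E)).definable (ε / 4) (by positivity)
    let v (g : Aut M.str) (c : E.ι ⊕ E.ι) : M.str.carrier (Sum.elim E.srt E.srt c) :=
      Sum.rec (motive := fun c => M.str.carrier (Sum.elim E.srt E.srt c))
        (fun a => g.toEquiv _ (t a)) (fun a => g₀.toEquiv _ (t a)) c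
    have hv : ∀ c, Continuous fun g => v g c := by
      rintro (a | a)
      · exact Aut.continuous_apply (t a)
      · exact continuous_const
    have hφ : Continuous fun g => φ.eval M.str fun k => v g (ρ k) :=
      (φ.uniformContinuous M.str).continuous.comp (continuous_pi fun k => hv (ρ k))
    have hd : ∀ g : Aut M.str,
        |dist (g • E.rep t) (g₀ • E.rep t) - φ.eval M.str fun k => v g (ρ k)| ≤ ε / 4 := by
      intro g
      rw [E.smul_def, E.smul_def, E.map_rep, E.map_rep]
      exact h M (v g)
    filter_upwards [Metric.tendsto_nhds.1 (hφ.tendsto g₀) (ε / 4) (by positivity)] with g hg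
    have h1 := hd g
    have h2 := hd g₀
    rw [dist_self] at h2
    rw [Real.dist_eq] at hg
    rw [abs_lt] at hg
    rw [abs_le] at h1 h2
    linarith [h1.1, h1.2, h2.1, h2.2, hg.1, hg.2]
  refine continuous_of_uniform_approx_of_continuous fun u hu => ?_
  obtain ⟨ε, hε, hu⟩ := Metric.mem_uniformity_dist.1 hu
  obtain ⟨t, ht⟩ := E.exists_dist_rep_lt x hε
  refine ⟨_, hrep t, fun g => hu ?_⟩
  rw [E.smul_def, E.smul_def, (E.isometry_map _).dist_eq]
  exact ht

/-! ### Hilbert spaces of kernels and closed spans -/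

/-- A realisation of a kernel by vectors of a Hilbert space extends to an isometric embedding of
the Hilbert space of the kernel. -/
theorem PSDKernel.exists_linearIsometry {X : Type v} {V : Type w} [AddCommGroup V] [Module ℝ V]
    (k : PSDKernel X V) {H : Type*} [NormedAddCommGroup H] [InnerProductSpace ℝ H]
    [CompleteSpace H] (Φ : X → V →ₗ[ℝ] H)
    (hΦ : ∀ x y a b, inner ℝ (Φ x a) (Φ y b) = k.form x y a b) :
    ∃ U : k.Hilbert →ₗᵢ[ℝ] H, ∀ x a, U (k.vec x a) = Φ x a := by
  let A : k.Pre →ₗ[ℝ] H := (Finsupp.lsum ℝ Φ).comp k.toPre.symm.toLinearMap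
  have hA : ∀ f : X →₀ V, A (k.toPre f) = f.sum fun x a => Φ x a := fun f => rfl
  have hn : ∀ z, ‖A z‖ = ‖z‖ := by
    intro z
    obtain ⟨f, rfl⟩ := k.toPre.surjective z
    rw [← sq_eq_sq₀ (norm_nonneg _) (norm_nonneg _), ← real_inner_self_eq_norm_sq,
      ← real_inner_self_eq_norm_sq, hA, inner_toPre]
    simp only [Finsupp.sum, sum_inner, inner_sum, hΦ]
    exact Finset.sum_comm
  let A' : k.Pre →ₗᵢ[ℝ] H := ⟨A, hn⟩
  let e : k.Pre →L[ℝ] k.Hilbert := UniformSpace.Completion.toComplL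
  have he : DenseRange e := UniformSpace.Completion.denseRange_coe
  have he' : IsUniformInducing e := UniformSpace.Completion.isUniformInducing_coe _
  let B : k.Hilbert →L[ℝ] H := A'.toContinuousLinearMap.extend e
  have hB : ∀ z, B (e z) = A z := fun z => ContinuousLinearMap.extend_eq _ he he' z
  refine ⟨⟨B.toLinearMap, fun z => ?_⟩, fun x a => ?_⟩
  · refine he.induction_on (p := fun z => ‖B z‖ = ‖z‖) z
      (isClosed_eq B.continuous.norm continuous_norm) fun w => ?_
    rw [hB, hn]
    exact (UniformSpace.Completion.norm_coe w).symm
  · refine (hB (k.toPre (Finsupp.single x a))).trans ?_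
    rw [hA]
    simp

/-- An isometry that intertwines two representations on the vectors `x ⊗ a` does so everywhere. -/
theorem PSDKernel.map_rep {X : Type v} {V : Type w} [AddCommGroup V] [Module ℝ V]
    (k : PSDKernel X V) {G : Type*} [Group G] [MulAction G X]
    (hk : ∀ (g : G) (x y : X), k.form (g • x) (g • y) = k.form x y) (g : G)
    {H : Type*} [NormedAddCommGroup H] [InnerProductSpace ℝ H] (U : k.Hilbert →ₗᵢ[ℝ] H)
    (e : H ≃ₗᵢ[ℝ] H) (h : ∀ x a, U (k.vec (g • x) a) = e (U (k.vec x a))) (z : k.Hilbert) :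
    U (k.rep hk g z) = e (U z) := by
  refine DFunLike.congr_fun (k.hom_ext
    (A := U.toContinuousLinearMap.comp (k.rep hk g).toLinearIsometry.toContinuousLinearMap)
    (B := e.toLinearIsometry.toContinuousLinearMap.comp U.toContinuousLinearMap)
    fun x a => ?_) z
  change U (k.rep hk g (k.vec x a)) = e (U (k.vec x a))
  rw [rep_vec, h]

section ClosedSpan

variable {H : Type*} [NormedAddCommGroup H] [InnerProductSpace ℝ H]

theorem subset_closedSpan (Y : Set H) : Y ⊆ closedSpan Y :=
  Submodule.subset_span.trans (Submodule.le_topologicalClosure _)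

theorem closedSpan_le {Y : Set H} {W : Submodule ℝ H} (hW : IsClosed (W : Set H)) (h : Y ⊆ W) :
    closedSpan Y ≤ W :=
  Submodule.topologicalClosure_minimal _ (Submodule.span_le.2 h) hW

theorem eq_zero_of_mem_closedSpan {Y : Set H} (A : H →L[ℝ] ℝ) (h : ∀ y ∈ Y, A y = 0) {x : H}
    (hx : x ∈ closedSpan Y) : A x = 0 :=
  closedSpan_le (W := A.toLinearMap.ker) (isClosed_eq A.continuous continuous_const) h hx

/-- Strong continuity of a unitary representation passes from a set of vectors to its closed
span. -/
theorem continuous_of_mem_closedSpan {G : Type*} [Group G] [TopologicalSpace G]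
    (π : G →* (H ≃ₗᵢ[ℝ] H)) {Y : Set H} (h : ∀ y ∈ Y, Continuous fun g => π g y) {x : H}
    (hx : x ∈ closedSpan Y) : Continuous fun g => π g x := by
  have hs : ∀ y ∈ Submodule.span ℝ Y, Continuous fun g => π g y := by
    intro y hy
    induction hy using Submodule.span_induction with
    | mem y hy => exact h y hy
    | zero => simpa using continuous_const
    | add y z _ _ hy hz => simp only [map_add]; exact hy.add hz
    | smul r y _ hy => simp only [map_smul]; exact hy.const_smul r
  refine continuous_of_uniform_approx_of_continuous fun u hu => ?_
  obtain ⟨ε, hε, hu⟩ := Metric.mem_uniformity_dist.1 hu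
  obtain ⟨y, hy, hxy⟩ := Metric.mem_closure_iff.1 hx ε hε
  exact ⟨_, hs y hy, fun g => hu (by rwa [(π g).isometry.dist_eq])⟩

end ClosedSpan

/-- The predicate `f(x, x)`. -/
def ImagPred₂.diagonal {S : ImagSort T} (f : ImagPred₂ S S) : ImagPred S where
  val M x := f.val M x x
  definable := f.definable.reindex (σ := S.srt) (Sum.elim id id) (by rintro (_ | _) <;> rfl)
  uc ε hε := by
    obtain ⟨δ, hδ, h⟩ := f.uc ε hε
    exact ⟨δ, hδ, fun M x y hxy => h M x y x y hxy hxy⟩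

namespace InterpretableHilbert

/-! ### Classes of realisations of an asymptotically free type -/

variable {𝓗 : InterpretableHilbert T} {i : 𝓗.I} {p : CompleteType (𝓗.piece i)}

theorem inner_eq_zero_of_bdd_ne (hp : AsymptoticallyFree p) {M : Model T}
    {x y : (𝓗.piece i).Elt M} (hx : x ∈ p.realisations M) (hy : y ∈ p.realisations M)
    (hxy : bdd x ≠ bdd y) : inner ℝ (𝓗.h i x) (𝓗.h i y) = 0 := by
  by_contra h
  rw [inner_h] at h
  have hf : ∀ (N : Model T), ∀ x ∈ p.realisations N, ∀ ε : ℝ, 0 < ε →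
      IsCompact {y ∈ p.realisations N | ε ≤ |(𝓗.ip i i).val N x y|} := by
    simpa only [AsymptoticallyFree, inner_h] using hp
  refine hxy ((bdd_subset_bdd hf hy hx ?_).antisymm (bdd_subset_bdd hf hx hy h))
  rwa [𝓗.symm]

/-- Realisations that are close have the same bounded closure: all realisations have the same norm
`r` in the Hilbert space, so those at distance less than `r` are not orthogonal; and if `r = 0`
there is only one realisation. -/
theorem exists_bdd_eq_of_dist_lt (hiso : 𝓗.IsometricPiece i) (hp : AsymptoticallyFree p)
    (M : Model T) : ∃ δ : ℝ, 0 < δ ∧ ∀ x ∈ p.realisations M, ∀ y ∈ p.realisations M,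
      dist x y < δ → bdd x = bdd y := by
  set s := p.val (𝓗.ip i i).diagonal with hs
  have hr : ∀ x ∈ p.realisations M, ‖𝓗.h i x‖ ^ 2 = s := fun x hx => by
    rw [← real_inner_self_eq_norm_sq, inner_h, hs]
    exact hx (𝓗.ip i i).diagonal
  rcases le_or_gt s 0 with h0 | h0
  · refine ⟨1, one_pos, fun x hx y hy _ => ?_⟩
    have hz : ∀ x ∈ p.realisations M, 𝓗.h i x = 0 := fun x hx =>
      norm_eq_zero.1 (pow_eq_zero_iff two_ne_zero |>.1
        (le_antisymm ((hr x hx).trans_le h0) (sq_nonneg _)))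
    rw [(hiso M).injective ((hz x hx).trans (hz y hy).symm)]
  · refine ⟨√s, Real.sqrt_pos.2 h0, fun x hx y hy hxy => ?_⟩
    by_contra hne
    have h1 := inner_eq_zero_of_bdd_ne hp hx hy hne
    have h2 := norm_sub_sq_real (𝓗.h i x) (𝓗.h i y)
    rw [h1, hr x hx, hr y hy, ← dist_eq_norm, (hiso M).dist_eq] at h2
    have h3 : dist x y ^ 2 < s := by
      rw [← Real.sq_sqrt h0.le]
      exact pow_lt_pow_left₀ hxy dist_nonneg two_ne_zero
    linarith

variable {M : Model T} {a : (𝓗.piece i).Elt M}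

open scoped Pointwise in
theorem mem_stab_iff (ha : a ∈ p.realisations M) {g : Aut M.str} :
    g ∈ stab p a ↔ bdd (g • a) = bdd a := by
  refine ⟨fun h => (smul_mem_bddClass p h ⟨ha, rfl⟩).2, fun h => ?_⟩
  refine MulAction.mem_stabilizer_iff.2 (Set.ext fun y => ?_)
  rw [Set.mem_smul_set_iff_inv_smul_mem]
  refine and_congr ⟨fun hy => ?_, fun hy => p.smul_mem g⁻¹ hy⟩ ?_
  · have := p.smul_mem g hy
    rwa [smul_inv_smul] at this
  · rw [← bdd_smul_eq_iff g, smul_inv_smul, h]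

theorem isOpen_stab (hiso : 𝓗.IsometricPiece i) (hp : AsymptoticallyFree p)
    (ha : a ∈ p.realisations M) : IsOpen (stab p a : Set (Aut M.str)) := by
  obtain ⟨δ, hδ, h⟩ := exists_bdd_eq_of_dist_lt hiso hp M
  refine isOpen_iff_mem_nhds.2 fun g₀ hg₀ => ?_
  filter_upwards [Metric.tendsto_nhds.1 (((𝓗.piece i).continuous_smul a).tendsto g₀) δ hδ]
    with g hg
  refine (mem_stab_iff ha).2 ?_
  rw [h _ (p.smul_mem g ha) _ (p.smul_mem g₀ ha) hg]
  exact (mem_stab_iff ha).1 hg₀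

/-- The automorphism group acts transitively on the classes `[x]`. -/
theorem exists_bdd_smul_eq (hiso : 𝓗.IsometricPiece i) (hp : AsymptoticallyFree p)
    (hdense : ∃ a₀ ∈ p.realisations M,
      p.realisations M ⊆ closure (MulAction.orbit (Aut M.str) a₀))
    (ha : a ∈ p.realisations M) {x : (𝓗.piece i).Elt M} (hx : x ∈ p.realisations M) :
    ∃ g : Aut M.str, bdd (g • a) = bdd x := by
  obtain ⟨a₀, ha₀, hdense⟩ := hdense
  obtain ⟨δ, hδ, h⟩ := exists_bdd_eq_of_dist_lt hiso hp M
  have key : ∀ x ∈ p.realisations M, ∃ g : Aut M.str, bdd (g • a₀) = bdd x := by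
    intro x hx
    obtain ⟨_, ⟨g, rfl⟩, hg⟩ := Metric.mem_closure_iff.1 (hdense hx) δ hδ
    exact ⟨g, (h x hx _ (p.smul_mem g ha₀) hg).symm⟩
  obtain ⟨g₁, h₁⟩ := key x hx
  obtain ⟨g₂, h₂⟩ := key a ha
  refine ⟨g₁ * g₂⁻¹, ?_⟩
  rw [← h₁, mul_smul, bdd_smul_eq_iff, ← bdd_smul_eq_iff g₂, smul_inv_smul, h₂]

/-- A translate of the span of a class by an element outside its stabiliser is orthogonal to it. -/
theorem inner_rep_eq_zero (hp : AsymptoticallyFree p) (ha : a ∈ p.realisations M) {g : Aut M.str}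
    (hg : g ∉ stab p a) {v w : 𝓗.space M} (hv : v ∈ classSpan p a) (hw : w ∈ classSpan p a) :
    inner ℝ v (𝓗.rep M g w) = 0 := by
  have h1 : ∀ x ∈ bddClass p a, ∀ w ∈ classSpan p a, inner ℝ (𝓗.h i x) (𝓗.rep M g w) = 0 := by
    intro x hx w hw
    refine eq_zero_of_mem_closedSpan ((innerSL ℝ (𝓗.h i x)).comp
      (𝓗.rep M g).toLinearIsometry.toContinuousLinearMap) ?_ hw
    rintro _ ⟨y, hy, rfl⟩
    change inner ℝ (𝓗.h i x) (𝓗.rep M g (𝓗.h i y)) = 0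
    rw [rep_h]
    refine inner_eq_zero_of_bdd_ne hp hx.1 (p.smul_mem g hy.1) fun h => hg ?_
    rw [mem_stab_iff ha, ← hx.2, h, bdd_smul_eq_iff, hy.2]
  rw [real_inner_comm]
  refine eq_zero_of_mem_closedSpan (innerSL ℝ (𝓗.rep M g w)) ?_ hv
  rintro _ ⟨x, hx, rfl⟩
  exact (real_inner_comm _ _).trans (h1 x hx w hw)

/-! ### The representation on the space of the type -/

theorem continuous_repOn (hiso : 𝓗.IsometricPiece i) (p : CompleteType (𝓗.piece i)) :
    Continuous fun x : Aut M.str × subspace p M => repOn p M x.1 x.2 := by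
  refine continuous_prod_of_continuous_lipschitzWith' _ 1
    (fun g => (repOn p M g).isometry.lipschitz) fun x => ?_
  refine Continuous.subtype_mk ?_ _
  refine continuous_of_mem_closedSpan (𝓗.rep M) ?_ x.2
  rintro _ ⟨y, -, rfl⟩
  simp only [rep_h]
  exact (hiso M).continuous.comp ((𝓗.piece i).continuous_smul y)

/-- The equivalence is inverse to `g ⊗ v ↦ π(g) v`. -/
theorem unitarilyEquivalent_Ind (hiso : 𝓗.IsometricPiece i) (hp : AsymptoticallyFree p)
    (hdense : ∃ a₀ ∈ p.realisations M,
      p.realisations M ⊆ closure (MulAction.orbit (Aut M.str) a₀))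
    (ha : a ∈ p.realisations M) :
    UnitarilyEquivalent (repOn p M) (Ind (stab p a) (repClass p a)) := by
  have hcl : IsClosed (subspace p M : Set (𝓗.space M)) :=
    Submodule.isClosed_topologicalClosure _
  have : CompleteSpace (subspace p M) := hcl.completeSpace_coe
  have hle : classSpan p a ≤ subspace p M :=
    closedSpan_le hcl ((Set.image_mono fun x hx => hx.1).trans (subset_closedSpan _))
  let Φ (g : Aut M.str) : classSpan p a →ₗ[ℝ] subspace p M :=
    (repOn p M g).toLinearEquiv.toLinearMap.comp (Submodule.inclusion hle)
  have hΦ : ∀ g v, (Φ g v : 𝓗.space M) = 𝓗.rep M g v := fun _ _ => rfl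
  obtain ⟨U, hU⟩ := (inducedKernel (stab p a) (repClass p a)).exists_linearIsometry Φ <| by
    intro g g' v w
    have h1 : inner ℝ (Φ g v) (Φ g' w) = inner ℝ (v : 𝓗.space M) (𝓗.rep M (g⁻¹ * g') w) := by
      have e : 𝓗.rep M g' = 𝓗.rep M g * 𝓗.rep M (g⁻¹ * g') := by
        rw [← map_mul, mul_inv_cancel_left]
      rw [Submodule.coe_inner, hΦ, hΦ, e]
      exact (𝓗.rep M g).inner_map_map _ _
    rw [h1]
    by_cases hg : g⁻¹ * g' ∈ stab p a
    · simp only [inducedKernel, inducedForm, dif_pos hg]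
      rfl
    · simp only [inducedKernel, inducedForm, dif_neg hg]
      exact inner_rep_eq_zero hp ha hg v.2 w.2
  have hsurj : Function.Surjective U := by
    let U' := (subspace p M).subtypeₗᵢ.comp U
    have hle' : subspace p M ≤ LinearMap.range U'.toLinearMap := by
      refine closedSpan_le (U'.isometry.isClosedEmbedding.isClosed_range) ?_
      rintro _ ⟨x, hx, rfl⟩
      obtain ⟨g, hg⟩ := exists_bdd_smul_eq hiso hp hdense ha hx
      have hx' : g⁻¹ • x ∈ bddClass p a :=
        ⟨p.smul_mem _ hx, by rw [← bdd_smul_eq_iff g, smul_inv_smul, hg]⟩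
      refine ⟨(inducedKernel (stab p a) (repClass p a)).vec g
        ⟨𝓗.h i (g⁻¹ • x), subset_closedSpan _ ⟨_, hx', rfl⟩⟩, ?_⟩
      change ((U _ : subspace p M) : 𝓗.space M) = _
      rw [hU, hΦ, rep_h, smul_inv_smul]
    intro y
    obtain ⟨z, hz⟩ := hle' y.2
    exact ⟨z, Subtype.ext hz⟩
  let W := LinearIsometryEquiv.ofSurjective U hsurj
  have hW : ∀ g z, U (Ind (stab p a) (repClass p a) g z) = repOn p M g (U z) := by
    intro g z
    refine PSDKernel.map_rep _ _ g U (repOn p M g) (fun g' v => ?_) z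
    rw [hU, hU]
    change repOn p M (g * g') _ = repOn p M g (repOn p M g' _)
    rw [map_mul]
    rfl
  refine ⟨W.symm, fun g x => ?_⟩
  rw [LinearIsometryEquiv.symm_apply_eq]
  change _ = U _
  rw [hW]
  exact congrArg _ (W.apply_symm_apply x).symm

end InterpretableHilbert

end CL

end

theorem mainTheorem12 {L : CL.Lang.{u}} (T : CL.Theory L) (𝓗 : CL.InterpretableHilbert T) (i : 𝓗.I)
    (hiso : 𝓗.IsometricPiece i) (p : CL.CompleteType (𝓗.piece i)) (hp : CL.InterpretableHilbert.AsymptoticallyFree p)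
    (M : CL.Model T)
    (hdense : ∃ a₀ ∈ p.realisations M,
      p.realisations M ⊆ closure (MulAction.orbit (CL.Aut M.str) a₀))
    (a : (𝓗.piece i).Elt M) (ha : a ∈ p.realisations M) :
    IsOpen (CL.InterpretableHilbert.stab p a : Set (CL.Aut M.str)) ∧
    (Continuous fun x : CL.Aut M.str × CL.InterpretableHilbert.subspace p M => CL.InterpretableHilbert.repOn p M x.1 x.2) ∧
    CL.UnitarilyEquivalent (CL.InterpretableHilbert.repOn p M) (CL.Ind (CL.InterpretableHilbert.stab p a) (CL.InterpretableHilbert.repClass p a)) := by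
  exact ⟨CL.InterpretableHilbert.isOpen_stab hiso hp ha,
    CL.InterpretableHilbert.continuous_repOn hiso p,
    CL.InterpretableHilbert.unitarilyEquivalent_Ind hiso hp hdense ha⟩
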